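/- Let $r\ge 1$. A solution of the $A_r$ $Q$-system in a field $K$ is a family $R_{\alpha,n}\in K$ ($0\le\alpha\le r+1$, $n\in\mathbb Z$) with $R_{0,n}=R_{r+1,n}=1$ and $$R_{\alpha,n+1}R_{\alpha,n-1}=R_{\alpha,n}^2+R_{\alpha+1,n}R_{\alpha-1,n}\qquad(1\le\alpha\le r,\ n\in\mathbb Z).$$ Let $\mathbf m=(m_1,\dots,m_r)\in\mathbb Z^r$ be a Motzkin path in the fundamental domain $\mathcal M_r$, i.e. $|m_\alpha-m_{\alpha+1}|\le 1$ for $1\le\alpha<r$ and $\min_\alpha m_\alpha=0$, and let $\mathbf x_{\mathbf m}=(R_{\alpha,m_\alpha},R_{\alpha,m_\alpha+1})_{1\le\alpha\le r}$ be the corresponding seed. *Weights.* Put $\lambda_{\alpha,n}=R_{\alpha,n+1}/R_{\alpha,n}$, $\mu_{\alpha,n}=R_{\alpha,n}/R_{\alpha-1,n}$ and $$y_{2\alpha-1}=\frac{\lambda_{\alpha,m_\alpha}}{\lambda_{\alpha-1,m_{\alpha-1}}}\quad(1\le\alpha\le r+1),\qquad y_{2\alpha}=\frac{\mu_{\alpha+1,m_\alpha+1}}{\mu_{\alpha,m_\alpha}}\,A_\alpha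 B_\alpha\quad(1\le\alpha\le r),$$ where $A_\alpha=\lambda_{\alpha+1,m_{\alpha+1}}/\lambda_{\alpha+1,m_\alpha}$ if $m_\alpha=m_{\alpha+1}+1$ and $A_\alpha=1$ otherwise, and $B_\alpha=\lambda_{\alpha-1,m_\alpha}/\lambda_{\alpha-1,m_{\alpha-1}}$ if $m_{\alpha-1}=m_\alpha+1$ and $B_\alpha=1$ otherwise (as $\lambda_{0,n}=\lambda_{r+1,n}=1$, the choice of $m_0,m_{r+1}$ is irrelevant). *The graph $\Gamma_{\mathbf m}$.* Let $v_1=1$, let $v_{\alpha+1}=v_\alpha+2$ if $m_{\alpha+1}=m_\alpha+1$ and $v_{\alpha+1}=v_\alpha+1$ otherwise ($1\le\alpha<r$), and let $v_{r+1}=v_r+2$. The vertices are $0,1,\dots,v_{r+1}$, with root $0$, and a vertex $v_\alpha'$ for each $2\le\alpha\le r$ with $m_\alpha\ne m_{\alpha-1}+1$. For $1\le\alpha\le r$ the skeleton edge number $2\alpha$ joins $v_\alpha$ to $v_\alpha+1$. For $1\le\alpha\le r+1$ the skeleton edge number $2\alpha-1$ joins $v_\alpha$ to $v_\alpha'$ if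 $2\le\alpha\le r$ and $m_\alpha\ne m_{\alpha-1}+1$, and joins $v_\alpha-1$ to $v_\alpha$ otherwise. Each skeleton edge $j$ carries two oriented edges: one pointing away from the root (from the first to the second vertex just named), of weight $1$, and one pointing down, towards the root, of weight $y_j$. Moreover, for all $1\le\alpha<\beta\le r$ with $m_{\gamma+1}=m_\gamma-1$ for $\alpha\le\gamma<\beta$, there is an extra down-pointing edge $v_\beta+1\to v_\alpha$ of weight $\prod_{\gamma=\alpha}^{\beta}y_{2\gamma}\big/\prod_{\gamma=\alpha+1}^{\beta}y_{2\gamma-1}$. Let $\mathcal Z^{\Gamma_{\mathbf m}}_{0,0}(n)$ be the sum, over all paths on $\Gamma_{\mathbf m}$ from the root to itself with exactly $n$ down-pointing steps, of the product of the weights of the traversed edges. **Theorem.** Let $\mathbf m\in\mathcal M_r$. 1. In the field of rational functions over $\mathbb Q$ in $2r$ indeterminates there is exactly one solution of the $Q$-system whose seed $\mathbf x_{\mathbf m}$ consists of the $2r$ indeterminates, and none of its members is $0$. (Its members are the functional forms $(R_{\alpha,n})_{\mathbf m}(\mathbf x_{\mathbf m})$ of the $R_{\alpha,n}$ in terms of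 the seed $\mathbf x_{\mathbf m}$.) 2. For each $n\ge 0$ there are finitely many paths on $\Gamma_{\mathbf m}$ from the root to itself with $n$ down-pointing steps, and the weight of every edge of $\Gamma_{\mathbf m}$ is a Laurent monomial in $\mathbf x_{\mathbf m}$ with coefficient $1$ (whose exponents depend only on $\mathbf m$ and the edge). 3. For each $n\ge0$, for every solution of the $Q$-system without zero members in any field (in particular for the one in 1), $$R_{1,n+m_1}=R_{1,m_1}\,\mathcal Z^{\Gamma_{\mathbf m}}_{0,0}(n),$$ and $R_{1,n+m_1}=P(\mathbf x_{\mathbf m})$ for a Laurent polynomial $P$ with non-negative integer coefficients that depends only on $\mathbf m$ and $n$. -/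

import Mathlib

namespace QSystem

/-! ### Motzkin paths -/

/-- `(m 1, …, m r)` is a Motzkin path lying in the fundamental domain
`{m | min_α m α = 0}`.  The values of `m` outside `{1, …, r}` play no role.
The last clause forces `1 ≤ r`. -/
structure InFundamentalDomain (r : ℕ) (m : ℕ → ℤ) : Prop where
  motzkin : ∀ α, 1 ≤ α → α + 1 ≤ r → |m α - m (α + 1)| ≤ 1
  nonneg : ∀ α, 1 ≤ α → α ≤ r → 0 ≤ m α
  attained : ∃ α, 1 ≤ α ∧ α ≤ r ∧ m α = 0

/-! ### The `A_r` `Q`-system and its seeds -/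

/-- `R α n` (`0 ≤ α ≤ r + 1`, `n ∈ ℤ`) solves the `A_r` `Q`-system. -/
structure IsSolution {K : Type*} [Field K] (r : ℕ) (R : ℕ → ℤ → K) : Prop where
  left : ∀ n, R 0 n = 1
  right : ∀ n, R (r + 1) n = 1
  rel : ∀ α, 1 ≤ α → α ≤ r → ∀ n,
    R α (n + 1) * R α (n - 1) = R α n ^ 2 + R (α + 1) n * R (α - 1) n

/-- No `R α n` vanishes, so that every mutation (division by `R α n`) makes sense. -/
def Nonvanishing {K : Type*} [Field K] (r : ℕ) (R : ℕ → ℤ → K) : Prop :=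
  ∀ α, 1 ≤ α → α ≤ r → ∀ n, R α n ≠ 0

/-- The seed `x_m`: entry `(a, i)` is `R_{α, m_α + i}` with `α = a + 1` and `i ∈ {0, 1}`. -/
def seed {K : Type*} (r : ℕ) (m : ℕ → ℤ) (R : ℕ → ℤ → K) (p : Fin r × Fin 2) : K :=
  R (p.1.val + 1) (m (p.1.val + 1) + (p.2.val : ℤ))

/-- The field of rational functions in `2 r` indeterminates. -/
abbrev SeedField (r : ℕ) : Type := FractionRing (MvPolynomial (Fin r × Fin 2) ℚ)

/-- The indeterminates of `SeedField r`. -/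
noncomputable def seedVar (r : ℕ) (p : Fin r × Fin 2) : SeedField r :=
  algebraMap (MvPolynomial (Fin r × Fin 2) ℚ) (SeedField r) (MvPolynomial.X p)

/-- The Laurent monomial `∏ x_p ^ (k p)`. -/
def laurentMonomial {K : Type*} [Field K] {r : ℕ} (x : Fin r × Fin 2 → K)
    (k : Fin r × Fin 2 → ℤ) : K :=
  ∏ p, x p ^ k p

/-- A Laurent polynomial in `2 r` variables with non-negative integer coefficients:
a finitely supported family of coefficients indexed by exponent vectors. -/
abbrev PosLaurent (r : ℕ) : Type := (Fin r × Fin 2 → ℤ) →₀ ℕ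

/-- The value of a Laurent polynomial at `x`. -/
noncomputable def PosLaurent.eval {K : Type*} [Field K] {r : ℕ} (P : PosLaurent r)
    (x : Fin r × Fin 2 → K) : K :=
  P.sum fun k c => (c : K) * laurentMonomial x k

/-! ### The graph `Γ_m` -/

/-- Vertex labels: `spine i` is the vertex `i`, `side i` is the univalent vertex `i'`
attached to `i` by a horizontal edge. -/
inductive Vertex : Type
  | spine (i : ℕ)
  | side (i : ℕ)

/-- Oriented edges.  Skeleton edges number `2α - 1` are called `odd α`, those
number `2α` are called `even α`; each of them carries two orientations, away from the root
(`Up`) and towards the root (`Down`).  `extra α β` are the additional down-pointing edges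
inside the descending segments. -/
inductive Edge : Type
  | oddUp (α : ℕ)
  | oddDown (α : ℕ)
  | evenUp (α : ℕ)
  | evenDown (α : ℕ)
  | extra (α β : ℕ)

/-- Label of the lower end of the skeleton edge `2α` (`1 ≤ α ≤ r`).
If `α` is the `j`-th element of its descending segment, this is the label in `Γ_m` of the vertex
`j` of the graph piece of that segment.  The label goes up by `1` from `α` to `α + 1` if the
step is descending or flat (where the connecting edge `2α + 1` is horizontal), and by `2` if
the step is ascending (where the connecting edge is vertical).  For `α = r + 1` it is
the upper end of the last skeleton edge `2r + 1`, which is vertical. -/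
def level (r : ℕ) (m : ℕ → ℤ) (α : ℕ) : ℕ :=
  α + ((Finset.Ico 1 α).filter fun β => β = r ∨ m (β + 1) = m β + 1).card

/-- The skeleton edge `2α - 1` is horizontal: all of them are except the first one, the
last one, and those that come from an ascending step `α - 1 → α`. -/
def Horizontal (r : ℕ) (m : ℕ → ℤ) (α : ℕ) : Prop :=
  2 ≤ α ∧ α ≤ r ∧ m α ≠ m (α - 1) + 1

instance (r : ℕ) (m : ℕ → ℤ) (α : ℕ) : Decidable (Horizontal r m α) :=
  inferInstanceAs (Decidable (_ ∧ _ ∧ _))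

/-- The end closer to the root of the skeleton edge `2α - 1`. -/
def oddNear (r : ℕ) (m : ℕ → ℤ) (α : ℕ) : Vertex :=
  if Horizontal r m α then .spine (level r m α) else .spine (level r m α - 1)

/-- The end farther from the root of the skeleton edge `2α - 1`. -/
def oddFar (r : ℕ) (m : ℕ → ℤ) (α : ℕ) : Vertex :=
  if Horizontal r m α then .side (level r m α) else .spine (level r m α)

/-- Starting point of an oriented edge. -/
def Edge.src (r : ℕ) (m : ℕ → ℤ) : Edge → Vertex
  | .oddUp α => oddNear r m α
  | .oddDown α => oddFar r m α
  | .evenUp α => .spine (level r m α)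
  | .evenDown α => .spine (level r m α + 1)
  | .extra _ β => .spine (level r m β + 1)

/-- End point of an oriented edge. -/
def Edge.tgt (r : ℕ) (m : ℕ → ℤ) : Edge → Vertex
  | .oddUp α => oddFar r m α
  | .oddDown α => oddNear r m α
  | .evenUp α => .spine (level r m α + 1)
  | .evenDown α => .spine (level r m α)
  | .extra α _ => .spine (level r m α)

/-- The oriented edges of `Γ_m`.  There is an extra edge for each pair `α < β` in the same
descending segment; for a segment `α_i, …, α_i + k - 1` these are the edges `a → b`,
`k + 1 ≥ a > b + 1 ≥ 2`, of its graph piece, with `α = α_i + b - 1`, `β = α_i + a - 2`.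
Distinct edges never share both starting point and end point, so a path on `Γ_m` may be
recorded by its edges instead of its vertices. -/
def IsEdge (r : ℕ) (m : ℕ → ℤ) : Edge → Prop
  | .oddUp α => 1 ≤ α ∧ α ≤ r + 1
  | .oddDown α => 1 ≤ α ∧ α ≤ r + 1
  | .evenUp α => 1 ≤ α ∧ α ≤ r
  | .evenDown α => 1 ≤ α ∧ α ≤ r
  | .extra α β => 1 ≤ α ∧ α < β ∧ β ≤ r ∧ ∀ γ, α ≤ γ → γ < β → m (γ + 1) = m γ - 1

/-- `1` for an edge pointing towards the root, `0` otherwise. -/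
def Edge.down : Edge → ℕ
  | .oddUp _ => 0
  | .oddDown _ => 1
  | .evenUp _ => 0
  | .evenDown _ => 1
  | .extra _ _ => 1

/-! ### The weights -/

section Weights

variable {K : Type*} [Field K]

/-- `λ_{α,n} = R_{α,n+1} / R_{α,n}`. -/
def lam (R : ℕ → ℤ → K) (α : ℕ) (n : ℤ) : K := R α (n + 1) / R α n

/-- `μ_{α,n} = R_{α,n} / R_{α-1,n}`, for `α ≥ 1`. -/
def mu (R : ℕ → ℤ → K) (α : ℕ) (n : ℤ) : K := R α n / R (α - 1) n

/-- The skeleton weight `y_{2α-1}(m)`, `1 ≤ α ≤ r + 1`. -/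
def yOdd (m : ℕ → ℤ) (R : ℕ → ℤ → K) (α : ℕ) : K :=
  lam R α (m α) / lam R (α - 1) (m (α - 1))

/-- The skeleton weight `y_{2α}(m)`, `1 ≤ α ≤ r`.  For `α = r` (resp. `α = 1`) the first
(resp. second) bracket is `1` in either case, since `λ_{r+1,n} = λ_{0,n} = 1`. -/
def yEven (m : ℕ → ℤ) (R : ℕ → ℤ → K) (α : ℕ) : K :=
  mu R (α + 1) (m α + 1) / mu R α (m α) *
    (if m α = m (α + 1) + 1 then lam R (α + 1) (m (α + 1)) / lam R (α + 1) (m α) else 1) *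
    (if m (α - 1) = m α + 1 then lam R (α - 1) (m α) / lam R (α - 1) (m (α - 1)) else 1)

/-- The weight of an oriented edge: `1` away from the root, `y` for the down-pointing
skeleton edges, and `∏_{b ≤ i < a} y_{i+1,i} / ∏_{b < i < a} y_{i',i}` for an extra edge
`a → b`. -/
def Edge.weight (m : ℕ → ℤ) (R : ℕ → ℤ → K) : Edge → K
  | .oddUp _ => 1
  | .oddDown α => yOdd m R α
  | .evenUp _ => 1
  | .evenDown α => yEven m R α
  | .extra α β => (∏ γ ∈ Finset.Icc α β, yEven m R γ) / ∏ γ ∈ Finset.Ioc α β, yOdd m R γ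

end Weights

/-! ### Paths -/

/-- The list of edges `l` is a path on `Γ_m` from `a` to `b`. -/
def IsPath (r : ℕ) (m : ℕ → ℤ) : Vertex → List Edge → Vertex → Prop
  | a, [], b => a = b
  | a, e :: l, b => IsEdge r m e ∧ e.src r m = a ∧ IsPath r m (e.tgt r m) l b

/-- Paths on `Γ_m` from the root `0` to itself with `n` down-pointing steps. -/
def rootPaths (r : ℕ) (m : ℕ → ℤ) (n : ℕ) : Set (List Edge) :=
  {l | IsPath r m (.spine 0) l (.spine 0) ∧ (l.map Edge.down).sum = n}

/-- The partition function `Z_{0,0}^{Γ_m}(n)` of the weighted paths in `rootPaths r m n`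
(a finite set). -/
noncomputable def pathZ {K : Type*} [Field K] (r : ℕ) (m : ℕ → ℤ) (R : ℕ → ℤ → K) (n : ℕ) : K :=
  ∑ᶠ l ∈ rootPaths r m n, (l.map (Edge.weight m R)).prod

end QSystem

/-! Up to signs, the `Q`-system is the recursion for Hankel-type determinants of the sequence `R 1
k`. Let `L` be the functional `x ^ k ↦ R 1 k` on Laurent polynomials. For each degree `a` and window
`n` there is a monic polynomial `p_{a,n}` with `L (x ^ j * p_{a,n}) = 0` for `n - a < j ≤ n`;
`moment` records the numbers `L (x ^ k * p_{a,n})` without any determinant. These obey two linear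
relations, one raising the degree (taken as the definition) and one shifting the window
(`moment_shift`), whose compatibility is the `Q`-system. Continuing the solution by `0` above `r +
1` makes `p_{r+1,n}` independent of `n` and orthogonal to everything (`moment_top`).

The paths from a vertex to the root satisfy a first-step recursion. After elimination of the odd
edges, only the upper ends of the even edges occur on the left (`pathSum_upper_succ`). The claim is
that, up to the factor `R 1 (m 1)`, the partition function at the upper end of the edge `2α` is the
moment of `p_{α, m α}` at `n + m 1 - α`. Both sides satisfy the same recursion:
`descentCoeff_mul_moment` combines the two linear relations in the ascending, flat and descending
cases, and `descentSum_eq` telescopes the extra edges of a descending segment. Induction on `n` then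
gives the path formula at the root.

Positivity follows because each weight is a Laurent monomial in the seed: the brackets in `yEven`
cancel the members outside the seed. Existence of the generic solution is obtained inside the
subtraction-free rational functions, where no division by zero can occur; uniqueness is propagation
from the seed in both directions. -/

namespace QSystem

/-! ### The linear problem attached to a solution -/

section Linear

variable {K : Type*} [Field K]

/-- A solution of the `Q`-system continued by `0` above the line `α = r + 1`. -/
structure IsExtendedSolution (r : ℕ) (Q : ℕ → ℤ → K) : Prop where
  left : ∀ n, Q 0 n = 1
  right : ∀ n, Q (r + 1) n = 1
  above : ∀ n, Q (r + 2) n = 0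
  ne_zero : ∀ α ≤ r + 1, ∀ n, Q α n ≠ 0
  rel : ∀ α ≤ r, ∀ n, Q (α + 1) (n + 1) * Q (α + 1) (n - 1) =
    Q (α + 1) n ^ 2 + Q (α + 2) n * Q α n

/-- The coefficient of the relation that raises the degree. -/
def raiseCoeff (Q : ℕ → ℤ → K) (a : ℕ) (n : ℤ) : K :=
  Q (a + 1) (n + 1) * Q a (n - 1) / (Q a n * Q (a + 1) n)

/-- The coefficient of the relation that shifts the window. -/
def shiftCoeff (Q : ℕ → ℤ → K) (a : ℕ) (n : ℤ) : K :=
  Q (a + 2) n * Q a (n - 1) / (Q (a + 1) (n - 1) * Q (a + 1) n)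

/-- If `L` is the functional `x ^ k ↦ Q 1 k` on Laurent polynomials, then `moment Q a n k` is
`L (x ^ k * p)`, with `p` the monic polynomial of degree `a` such that `L (x ^ j * p) = 0` for
`n - a < j ≤ n`. -/
def moment (Q : ℕ → ℤ → K) : ℕ → ℤ → ℤ → K
  | 0, _, k => Q 1 k
  | a + 1, n, k => moment Q a n (k + 1) - raiseCoeff Q a n * moment Q a (n - 1) k

variable {r : ℕ} {Q : ℕ → ℤ → K}

/-- Together with `raiseCoeff_mul_shiftCoeff` this is the compatibility of raising and shifting. It
is the only place where two neighbouring `Q`-system relations are combined. -/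
theorem IsExtendedSolution.shiftCoeff_succ (h : IsExtendedSolution r Q) {a : ℕ} (ha : a + 1 ≤ r)
    (n : ℤ) : shiftCoeff Q (a + 1) n =
      shiftCoeff Q a n + raiseCoeff Q (a + 1) n - raiseCoeff Q (a + 1) (n - 1) := by
  have h1 := h.ne_zero (a + 1) (by omega)
  have h2 := h.ne_zero (a + 2) (by omega)
  have e1 := h.rel (a + 1) ha n
  have e2 := h.rel a (by omega) (n - 1)
  simp only [shiftCoeff, raiseCoeff, sub_add_cancel] at *
  have := h1 n; have := h1 (n - 1); have := h2 n; have := h2 (n - 1)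
  field_simp
  linear_combination Q (a + 2) n ^ 2 * e2 - Q (a + 1) (n - 1) ^ 2 * e1

theorem IsExtendedSolution.raiseCoeff_mul_shiftCoeff (h : IsExtendedSolution r Q) {a : ℕ}
    (ha : a + 1 ≤ r) (n : ℤ) : raiseCoeff Q (a + 1) (n - 1) * shiftCoeff Q a (n - 1) =
      shiftCoeff Q a n * raiseCoeff Q a (n - 1) := by
  have h0 := h.ne_zero a (by omega)
  have h1 := h.ne_zero (a + 1) (by omega)
  have h2 := h.ne_zero (a + 2) (by omega)
  simp only [shiftCoeff, raiseCoeff, sub_add_cancel]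
  have := h1 n; have := h1 (n - 1); have := h2 n; have := h2 (n - 1)
  have := h1 (n - 1 - 1); have := h0 (n - 1)
  field_simp

/-- In terms of polynomials, `p_{a+1,n}` and `p_{a+1,n-1}` are both monic and share `a`
orthogonality conditions, so they should differ by a multiple of `p_{a,n-1}`. The induction on the
degree uses the compatibility identities instead. -/
theorem IsExtendedSolution.moment_shift (h : IsExtendedSolution r Q) {a : ℕ} (ha : a ≤ r)
    (n k : ℤ) : moment Q (a + 1) n k =
      moment Q (a + 1) (n - 1) k - shiftCoeff Q a n * moment Q a (n - 1) k := by
  induction a generalizing n k with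
  | zero =>
    have h1 := h.ne_zero 1 (by omega)
    have e := h.rel 0 (by omega) n
    have := h1 n; have := h1 (n - 1)
    simp only [moment, shiftCoeff, raiseCoeff, h.left, sub_add_cancel, zero_add] at *
    field_simp
    linear_combination (-(Q 1 k)) * e
  | succ a ih =>
    have i1 := ih (by omega) n (k + 1)
    have i2 := ih (by omega) (n - 1) k
    have e1 := h.shiftCoeff_succ ha n
    have e2 := h.raiseCoeff_mul_shiftCoeff ha n
    have d0 : ∀ b n k, moment Q (b + 1) n k =
      moment Q b n (k + 1) - raiseCoeff Q b n * moment Q b (n - 1) k := fun _ _ _ => rfl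
    have d1 := d0 a (n - 1) k
    rw [d0 (a + 1) n, d0 (a + 1) (n - 1), i1, e1]
    linear_combination (-raiseCoeff Q (a + 1) (n - 1)) * i2 + (moment Q a (n - 1 - 1) k) * e2
      + shiftCoeff Q a n * d1

/-- The two parts feed each other: vanishing for the window `n + 1`, rewritten by `moment_shift`,
gives the first nonzero moment in the next degree, and that value makes the next raising step
vanish. -/
theorem IsExtendedSolution.moment_self (h : IsExtendedSolution r Q) {a : ℕ} (ha : a ≤ r) (n : ℤ) :
    moment Q (a + 1) n n = 0 ∧ moment Q a n (n + 1) = Q (a + 1) (n + 1) / Q a n := by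
  induction a generalizing n with
  | zero =>
    have h1 := h.ne_zero 1 (by omega) n
    constructor
    · simp only [moment, raiseCoeff, h.left, zero_add]
      field_simp
      ring
    · simp [moment, h.left]
  | succ a ih =>
    have h0 := h.ne_zero a (by omega)
    have h1 := h.ne_zero (a + 1) (by omega)
    have h2 := h.ne_zero (a + 2) (by omega)
    have key : ∀ n, moment Q (a + 1) n (n + 1) = Q (a + 2) (n + 1) / Q (a + 1) n := by
      intro n
      have i := (ih (by omega) (n + 1)).1
      rw [h.moment_shift (by omega), add_sub_cancel_right, (ih (by omega) n).2, shiftCoeff,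
        add_sub_cancel_right] at i
      rw [sub_eq_zero.1 i]
      have := h1 n; have := h1 (n + 1); have := h0 n
      field_simp
    refine ⟨?_, key n⟩
    rw [moment, key]
    have k' := key (n - 1)
    rw [sub_add_cancel] at k'
    rw [k', raiseCoeff]
    have := h1 n; have := h1 (n - 1); have := h2 n
    field_simp
    ring

/-- For `k < n` both terms of the raising relation lie in smaller windows; only the end `k = n`
needs `moment_self`. -/
theorem IsExtendedSolution.moment_eq_zero (h : IsExtendedSolution r Q) {a : ℕ} (ha : a ≤ r + 1)
    {n k : ℤ} (h1 : n - a < k) (h2 : k ≤ n) : moment Q a n k = 0 := by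
  induction a generalizing n k with
  | zero => simp at h1; omega
  | succ a ih =>
    rcases h2.eq_or_lt with rfl | h2
    · exact (h.moment_self (by omega) k).1
    · push_cast at h1
      rw [moment, ih (by omega) (by omega) (by omega), ih (by omega) (by omega) (by omega)]
      simp

/-- In degree `r + 1` the shift coefficient contains `Q (r + 2) n = 0`, so the window can be moved
freely until it ends at `k`. -/
theorem IsExtendedSolution.moment_top (h : IsExtendedSolution r Q) (n k : ℤ) :
    moment Q (r + 1) n k = 0 := by
  have step : ∀ n, moment Q (r + 1) n k = moment Q (r + 1) (n - 1) k := fun n => by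
    rw [h.moment_shift le_rfl, shiftCoeff, h.above]; simp
  have : ∀ j : ℤ, moment Q (r + 1) (k + j) k = 0 := by
    intro j
    induction j using Int.induction_on with
    | zero => simpa using (h.moment_self le_rfl k).1
    | succ i ih => rw [step, ← add_assoc, add_sub_cancel_right, ih]
    | pred i ih => rw [← add_sub_assoc, ← step, ih]
  simpa using this (n - k)

end Linear

/-! ### Levels and paths -/

section Paths

variable {r : ℕ} {m : ℕ → ℤ}

/-- The edge `2α + 1` is vertical, and leads from the upper end of the edge `2α` to a new
vertex. -/
def Ascending (r : ℕ) (m : ℕ → ℤ) (α : ℕ) : Prop := α = r ∨ m (α + 1) = m α + 1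

instance (r : ℕ) (m : ℕ → ℤ) (α : ℕ) : Decidable (Ascending r m α) :=
  inferInstanceAs (Decidable (_ ∨ _))

theorem level_one : level r m 1 = 1 := by simp [level]

theorem level_succ {α : ℕ} (hα : 1 ≤ α) :
    level r m (α + 1) = level r m α + if Ascending r m α then 2 else 1 := by
  unfold level
  rw [← Finset.insert_Ico_right_eq_Ico_add_one hα, Finset.filter_insert]
  by_cases h : Ascending r m α
  · have h' : α = r ∨ m (α + 1) = m α + 1 := h
    rw [if_pos h', if_pos h, Finset.card_insert_of_notMem (by simp)]
    omega
  · have h' : ¬(α = r ∨ m (α + 1) = m α + 1) := h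
    rw [if_neg h', if_neg h]
    omega

theorem level_add_le {α : ℕ} (hα : 1 ≤ α) (j : ℕ) : level r m α + j ≤ level r m (α + j) := by
  induction j with
  | zero => rfl
  | succ j ih =>
    rw [← add_assoc, ← add_assoc, level_succ (by omega)]
    split_ifs <;> omega

theorem level_lt {α β : ℕ} (hα : 1 ≤ α) (h : α < β) : level r m α < level r m β := by
  have := level_add_le (r := r) (m := m) hα (β - α)
  rw [Nat.add_sub_cancel' h.le] at this
  omega

theorem level_inj {α β : ℕ} (hα : 1 ≤ α) (hβ : 1 ≤ β) : level r m α = level r m β ↔ α = β := by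
  refine ⟨fun h => ?_, fun h => h ▸ rfl⟩
  rcases lt_trichotomy α β with h' | h' | h'
  · have := level_lt (r := r) (m := m) hα h'
    omega
  · exact h'
  · have := level_lt (r := r) (m := m) hβ h'
    omega

/-- Two even edges are glued end to end exactly when they are consecutive and the odd edge between
them is horizontal. -/
theorem level_eq_level_add_one {α β : ℕ} (hα : 1 ≤ α) (hβ : 1 ≤ β) :
    level r m β = level r m α + 1 ↔ β = α + 1 ∧ ¬Ascending r m α := by
  constructor
  · intro h
    have hlt : α < β := by
      by_contra hn
      rcases (not_lt.1 hn).eq_or_lt with rfl | h'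
      · omega
      · have := level_lt (r := r) (m := m) hβ h'
        omega
    have h1 := level_add_le (r := r) (m := m) hα (β - α)
    rw [Nat.add_sub_cancel' hlt.le] at h1
    obtain rfl : β = α + 1 := by omega
    refine ⟨rfl, fun hA => ?_⟩
    rw [level_succ hα, if_pos hA] at h
    omega
  · rintro ⟨rfl, h⟩
    rw [level_succ hα, if_neg h]

theorem one_le_level {α : ℕ} (hα : 1 ≤ α) : 1 ≤ level r m α := by
  unfold level
  omega

theorem horizontal_succ_iff {α : ℕ} (hα : 1 ≤ α) (hr : α ≤ r) :
    Horizontal r m (α + 1) ↔ ¬Ascending r m α := by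
  unfold Horizontal Ascending
  rw [Nat.add_sub_cancel]
  constructor
  · rintro ⟨h1, h2, h3⟩
    rintro (rfl | h)
    · omega
    · exact h3 h
  · intro h
    push Not at h
    exact ⟨by omega, by omega, h.2⟩

theorem not_horizontal_one : ¬Horizontal r m 1 := fun h => by
  have := h.1
  omega

theorem oddNear_one : oddNear r m 1 = .spine 0 := by
  rw [oddNear, if_neg not_horizontal_one, level_one]

/-- Vertical or horizontal, the edge `2α + 1` leaves from the upper end of the edge `2α`; this
allows one recursion for both shapes. -/
theorem oddNear_succ {α : ℕ} (hα : 1 ≤ α) (hr : α ≤ r) :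
    oddNear r m (α + 1) = .spine (level r m α + 1) := by
  unfold oddNear
  by_cases h : Ascending r m α
  · rw [if_neg (by rw [horizontal_succ_iff hα hr]; exact not_not.2 h), level_succ hα, if_pos h]
    rfl
  · rw [if_pos ((horizontal_succ_iff hα hr).2 h), level_succ hα, if_neg h]

/-! ### Finiteness of the path sets and the first-step decomposition -/

/-- The distance of a vertex from the root along the skeleton. -/
def Vertex.height : Vertex → ℕ
  | .spine i => i
  | .side i => i + 1

theorem height_tgt_of_up {e : Edge} (he : IsEdge r m e) (hd : e.down = 0) :
    (e.tgt r m).height = (e.src r m).height + 1 ∧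
      (e.tgt r m).height ≤ level r m (r + 1) + 1 := by
  have key : ∀ α, 1 ≤ α → α ≤ r + 1 → level r m α ≤ level r m (r + 1) := by
    intro α h1 h2
    rcases h2.eq_or_lt with rfl | h2
    · rfl
    · exact (level_lt h1 h2).le
  cases e with
  | oddUp α =>
    have h1 := key α he.1 he.2
    have h2 := one_le_level (r := r) (m := m) he.1
    simp only [Edge.tgt, Edge.src, oddFar, oddNear]
    constructor <;> split_ifs <;> simp only [Vertex.height] <;> omega
  | evenUp α =>
    have h1 := key α he.1 (by have := he.2; omega)
    constructor <;> simp only [Edge.tgt, Edge.src, Vertex.height]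
    omega
  | oddDown α => simp [Edge.down] at hd
  | evenDown α => simp [Edge.down] at hd
  | extra α β => simp [Edge.down] at hd

theorem finite_isEdge : {e | IsEdge r m e}.Finite := by
  have hs : {e | IsEdge r m e} ⊆ Set.image Edge.oddUp (Set.Iic (r + 1)) ∪
      Set.image Edge.oddDown (Set.Iic (r + 1)) ∪
      Set.image Edge.evenUp (Set.Iic r) ∪ Set.image Edge.evenDown (Set.Iic r) ∪
      Set.image2 Edge.extra (Set.Iic r) (Set.Iic r) := by
    intro e he
    cases e with
    | oddUp α => simpa using he.2
    | evenUp α => simpa using he.2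
    | oddDown α => simpa using he.2
    | evenDown α => simpa using he.2
    | extra α β =>
      right
      have h1 := he.2.1
      have h2 := he.2.2.1
      exact Set.mem_image2_of_mem (Set.mem_Iic.2 (by omega)) h2
  refine Set.Finite.subset ?_ hs
  have f1 := Set.finite_Iic (r + 1)
  have f2 := Set.finite_Iic r
  exact ((((f1.image _).union (f1.image _)).union (f2.image _)).union (f2.image _)).union
    (f2.image2 _ f2)

/-- Paths from `v` to the root with `n` down-pointing steps. -/
def pathsToRoot (r : ℕ) (m : ℕ → ℤ) (v : Vertex) (n : ℕ) : Set (List Edge) :=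
  {l | IsPath r m v l (.spine 0) ∧ (l.map Edge.down).sum = n}

theorem nil_mem_pathsToRoot {v : Vertex} {n : ℕ} :
    [] ∈ pathsToRoot r m v n ↔ v = .spine 0 ∧ n = 0 := by
  simp [pathsToRoot, IsPath, eq_comm]

theorem cons_mem_pathsToRoot {v : Vertex} {n : ℕ} {e : Edge} {l : List Edge} :
    e :: l ∈ pathsToRoot r m v n ↔ (IsEdge r m e ∧ e.src r m = v) ∧ e.down ≤ n ∧
      l ∈ pathsToRoot r m (e.tgt r m) (n - e.down) := by
  simp only [pathsToRoot, IsPath, Set.mem_ofPred_eq, List.map_cons, List.sum_cons]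
  constructor
  · rintro ⟨⟨h1, h2, h3⟩, h4⟩
    exact ⟨⟨h1, h2⟩, by omega, h3, by omega⟩
  · rintro ⟨⟨h1, h2⟩, h4, h3, h5⟩
    exact ⟨⟨h1, h2, h3⟩, by omega⟩

/-- Lexicographic induction: a down step lowers `n`, while an up step keeps `n` and reduces the
remaining distance to the bounded maximal height. -/
theorem finite_pathsToRoot (v : Vertex) (n : ℕ) : (pathsToRoot r m v n).Finite := by
  induction n using Nat.strong_induction_on generalizing v with
  | _ n ih =>
  induction hj : level r m (r + 1) + 1 - v.height using Nat.strong_induction_on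
    generalizing v with
  | _ j ihj =>
  have hs : pathsToRoot r m v n ⊆ {[]} ∪ ⋃ e ∈ {e | IsEdge r m e ∧ e.src r m = v ∧ e.down ≤ n},
      Set.image (List.cons e) (pathsToRoot r m (e.tgt r m) (n - e.down)) := by
    intro l hl
    cases l with
    | nil => simp
    | cons e l =>
      obtain ⟨⟨h1, h2⟩, h3, h4⟩ := cons_mem_pathsToRoot.1 hl
      right
      exact Set.mem_biUnion (show _ ∧ _ from ⟨h1, h2, h3⟩) (Set.mem_image_of_mem _ h4)
  refine Set.Finite.subset ((Set.finite_singleton _).union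
    (Set.Finite.biUnion (finite_isEdge.subset fun e he => he.1) ?_)) hs
  rintro e ⟨he, rfl, hd⟩
  refine Set.Finite.image _ ?_
  rcases Nat.eq_zero_or_pos e.down with h0 | h0
  · obtain ⟨h1, h2⟩ := height_tgt_of_up he h0
    rw [h0]
    exact ihj _ (by omega) _ rfl
  · exact ih _ (by omega) _

theorem height_of_mem_pathsToRoot_zero {v : Vertex} {l : List Edge}
    (h : l ∈ pathsToRoot r m v 0) : v.height + l.length = 0 := by
  induction l generalizing v with
  | nil => rw [(nil_mem_pathsToRoot.1 h).1]; rfl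
  | cons e l ih =>
    obtain ⟨⟨h1, h2⟩, h3, h4⟩ := cons_mem_pathsToRoot.1 h
    rw [Nat.zero_sub] at h4
    have := ih h4
    have := (height_tgt_of_up h1 (by omega)).1
    omega

variable {K : Type*} [Field K]

/-- The partition function of the paths from `v` to the root with `n` down-pointing steps. -/
noncomputable def pathSum (r : ℕ) (m : ℕ → ℤ) (R : ℕ → ℤ → K) (v : Vertex) (n : ℕ) : K :=
  ∑ᶠ l ∈ pathsToRoot r m v n, (l.map (Edge.weight m R)).prod

/-- Paths are sorted by their first edge. The hypothesis `hv` excludes the empty path, and the test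
`e.down ≤ n` guards the truncated subtraction. -/
theorem pathSum_eq_sum (R : ℕ → ℤ → K) {v : Vertex} {n : ℕ} {O : Finset Edge}
    (hO : ∀ e, e ∈ O ↔ IsEdge r m e ∧ e.src r m = v) (hv : ¬(v = .spine 0 ∧ n = 0)) :
    pathSum r m R v n = ∑ e ∈ O, if e.down ≤ n then
      e.weight m R * pathSum r m R (e.tgt r m) (n - e.down) else 0 := by
  classical
  have hsum : ∀ v n, pathSum r m R v n =
      ∑ l ∈ (finite_pathsToRoot (r := r) (m := m) v n).toFinset,
        (l.map (Edge.weight m R)).prod := fun v n =>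
    finsum_mem_eq_finite_toFinset_sum _ _
  rw [← Finset.sum_filter]
  simp_rw [hsum, Finset.mul_sum]
  rw [Finset.sum_sigma']
  symm
  refine Finset.sum_bij (fun x _ => x.1 :: x.2) ?_ ?_ ?_ ?_
  · rintro ⟨e, l⟩ h
    simp only [Finset.mem_sigma, Finset.mem_filter, Set.Finite.mem_toFinset, hO] at h ⊢
    exact cons_mem_pathsToRoot.2 ⟨h.1.1, h.1.2, h.2⟩
  · rintro ⟨e, l⟩ _ ⟨e', l'⟩ _ h
    obtain ⟨rfl, rfl⟩ := List.cons.inj h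
    rfl
  · intro l hl
    rw [Set.Finite.mem_toFinset] at hl
    cases l with
    | nil => exact absurd (nil_mem_pathsToRoot.1 hl) hv
    | cons e l =>
      obtain ⟨h1, h2, h3⟩ := cons_mem_pathsToRoot.1 hl
      exact ⟨⟨e, l⟩, by simp [hO, h1, h2, h3], rfl⟩
  · rintro ⟨e, l⟩ _
    simp

theorem pathSum_root_zero (R : ℕ → ℤ → K) : pathSum r m R (.spine 0) 0 = 1 := by
  have : pathsToRoot r m (.spine 0) 0 = {[]} := by
    ext l
    constructor
    · intro h
      have := height_of_mem_pathsToRoot_zero h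
      exact List.eq_nil_of_length_eq_zero (by omega)
    · rintro rfl
      exact nil_mem_pathsToRoot.2 ⟨rfl, rfl⟩
  rw [pathSum, this, finsum_mem_singleton]
  simp

theorem pathSum_zero_of_height_ne_zero (R : ℕ → ℤ → K) {v : Vertex} (hv : v.height ≠ 0) :
    pathSum r m R v 0 = 0 := by
  have : pathsToRoot r m v 0 = ∅ := by
    ext l
    refine ⟨fun h => ?_, fun h => h.elim⟩
    have := height_of_mem_pathsToRoot_zero h
    omega
  rw [pathSum, this, finsum_mem_empty]

end Paths

/-! ### Recursion for the partition functions -/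

section Recursion

variable {r : ℕ} {m : ℕ → ℤ} {K : Type*} [Field K]

open Classical in
/-- The indices `γ ≤ α` of the descending segment of `α`. -/
noncomputable def descendants (m : ℕ → ℤ) (α : ℕ) : Finset ℕ :=
  (Finset.Icc 1 α).filter fun γ => ∀ δ, γ ≤ δ → δ < α → m (δ + 1) = m δ - 1

theorem mem_descendants {α γ : ℕ} : γ ∈ descendants m α ↔
    (1 ≤ γ ∧ γ ≤ α) ∧ ∀ δ, γ ≤ δ → δ < α → m (δ + 1) = m δ - 1 := by
  classical
  simp [descendants]

/-- The contribution of the down-pointing edges that start at the upper end of the edge `2α`;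
`f γ` is the partition function of the lower end of the edge `2γ`. -/
noncomputable def descentSum (m : ℕ → ℤ) (R : ℕ → ℤ → K) (f : ℕ → K) (α : ℕ) : K :=
  ∑ γ ∈ descendants m α, Edge.weight m R (.extra γ α) * f γ

open Classical in
/-- The down-pointing edges that start at the upper end of the edge `2α`. -/
noncomputable def descents (m : ℕ → ℤ) (α : ℕ) : Finset Edge :=
  (descendants m α).image fun γ => if γ = α then .evenDown α else .extra γ α

theorem mem_descents {α : ℕ} (hα : 1 ≤ α) (hr : α ≤ r) {e : Edge} :
    e ∈ descents m α ↔ IsEdge r m e ∧ (e = .evenDown α ∨ ∃ γ, e = .extra γ α) := by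
  classical
  simp only [descents, Finset.mem_image, mem_descendants]
  constructor
  · rintro ⟨γ, ⟨⟨h1, h2⟩, h3⟩, rfl⟩
    split_ifs with h
    · exact ⟨⟨hα, hr⟩, Or.inl rfl⟩
    · exact ⟨⟨h1, by omega, hr, h3⟩, Or.inr ⟨γ, rfl⟩⟩
  · rintro ⟨he, rfl | ⟨γ, rfl⟩⟩
    · exact ⟨α, ⟨⟨hα, le_rfl⟩, fun δ _ _ => by omega⟩, if_pos rfl⟩
    · obtain ⟨h1, h2, h3, h4⟩ := he
      exact ⟨γ, ⟨⟨h1, h2.le⟩, h4⟩, if_neg h2.ne⟩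

/-- Although `extra α α` is not an edge, its weight formula has an empty denominator and equals
`yEven m R α`. So the skeleton edge joins the sum over extra edges as the term `γ = α`. -/
theorem sum_descents (R : ℕ → ℤ → K) (α n : ℕ) :
    (∑ e ∈ descents m α, if e.down ≤ n + 1 then
      e.weight m R * pathSum r m R (e.tgt r m) (n + 1 - e.down) else 0) =
    descentSum m R (fun γ => pathSum r m R (.spine (level r m γ)) n) α := by
  classical
  rw [descents, Finset.sum_image]
  · refine Finset.sum_congr rfl fun γ _ => ?_
    split_ifs with h1 h2 h2
    · subst h1
      simp [Edge.down, Edge.weight, Edge.tgt]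
    · simp [Edge.down] at h2
    · simp [Edge.down, Edge.tgt]
    · simp [Edge.down] at h2
  · intro γ _ γ' _ h
    dsimp only at h
    split_ifs at h with h1 h2 h2
    · rw [h1, h2]
    · injection h

theorem oddFar_eq_spine_iff {β i : ℕ} :
    oddFar r m β = .spine i ↔ ¬Horizontal r m β ∧ level r m β = i := by
  unfold oddFar
  split_ifs with h <;> simp [h]

theorem oddFar_eq_side_iff {β i : ℕ} :
    oddFar r m β = .side i ↔ Horizontal r m β ∧ level r m β = i := by
  unfold oddFar
  split_ifs with h <;> simp [h]

theorem exists_oddNear_eq {β : ℕ} (hβ : 1 ≤ β) (hr : β ≤ r + 1) :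
    (β = 1 ∧ oddNear r m β = .spine 0) ∨
      ∃ δ, β = δ + 1 ∧ 1 ≤ δ ∧ δ ≤ r ∧ oddNear r m β = .spine (level r m δ + 1) := by
  rcases hβ.eq_or_lt with rfl | h
  · exact Or.inl ⟨rfl, oddNear_one⟩
  · obtain ⟨δ, rfl⟩ : ∃ δ, β = δ + 1 := ⟨β - 1, by omega⟩
    exact Or.inr ⟨δ, rfl, by omega, by omega, oddNear_succ (by omega) (by omega)⟩

/-- The edges that start at the root. -/
theorem src_eq_root_iff {e : Edge} (he : IsEdge r m e) :
    e.src r m = .spine 0 ↔ e = .oddUp 1 := by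
  constructor
  · intro h
    cases e with
    | oddUp β =>
      rcases exists_oddNear_eq (m := m) he.1 he.2 with ⟨rfl, _⟩ | ⟨δ, _, _, _, h'⟩
      · rfl
      · simp [Edge.src, h'] at h
    | oddDown β =>
      have := (oddFar_eq_spine_iff.1 h).2
      have := one_le_level (r := r) (m := m) he.1
      omega
    | evenUp β =>
      have := one_le_level (r := r) (m := m) he.1
      have : level r m β = 0 := by simpa [Edge.src] using h
      omega
    | evenDown β => simp [Edge.src] at h
    | extra α β => simp [Edge.src] at h
  · rintro rfl
    exact oddNear_one

/-- The edges that start at the lower end of the edge `2α` if this is not the upper end of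
another even edge. -/
theorem src_eq_lower_iff {e : Edge} (he : IsEdge r m e) {α : ℕ} (hα : 1 ≤ α)
    (hA : ∀ δ, 1 ≤ δ → δ ≤ r → α = δ + 1 → Ascending r m δ) :
    e.src r m = .spine (level r m α) ↔ e = .evenUp α ∨ e = .oddDown α := by
  have hne : ∀ δ, 1 ≤ δ → δ ≤ r → level r m δ + 1 ≠ level r m α := by
    intro δ h1 h2 h
    obtain ⟨h3, h4⟩ := (level_eq_level_add_one h1 hα).1 h.symm
    exact h4 (hA δ h1 h2 h3)
  constructor
  · intro h
    cases e with
    | oddUp β =>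
      rcases exists_oddNear_eq (m := m) he.1 he.2 with ⟨rfl, h'⟩ | ⟨δ, _, h1, h2, h'⟩
      · have := one_le_level (r := r) (m := m) hα
        simp only [Edge.src, h', Vertex.spine.injEq] at h
        omega
      · simp only [Edge.src, h', Vertex.spine.injEq] at h
        exact absurd h (hne δ h1 h2)
    | oddDown β =>
      have := (oddFar_eq_spine_iff.1 h).2
      rw [level_inj he.1 hα] at this
      simp [this]
    | evenUp β =>
      simp only [Edge.src, Vertex.spine.injEq] at h
      rw [level_inj he.1 hα] at h
      simp [h]
    | evenDown β =>
      simp only [Edge.src, Vertex.spine.injEq] at h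
      exact absurd h (hne β he.1 he.2)
    | extra γ β =>
      simp only [Edge.src, Vertex.spine.injEq] at h
      have h1 := he.1
      have h2 := he.2.1
      exact absurd h (hne β (by omega) he.2.2.1)
  · rintro (rfl | rfl)
    · rfl
    · refine oddFar_eq_spine_iff.2 ⟨fun hH => ?_, rfl⟩
      obtain ⟨δ, rfl⟩ : ∃ δ, α = δ + 1 := ⟨α - 1, by omega⟩
      have h1 := hH.1
      have h2 := hH.2.1
      exact (horizontal_succ_iff (by omega) (by omega)).1 hH
        (hA δ (by omega) (by omega) rfl)

/-- The edges that start at a side vertex. -/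
theorem src_eq_side_iff {e : Edge} (he : IsEdge r m e) {α : ℕ} (hα : Horizontal r m α) :
    e.src r m = .side (level r m α) ↔ e = .oddDown α := by
  have h2 := hα.1
  constructor
  · intro h
    cases e with
    | oddUp β =>
      simp only [Edge.src, oddNear] at h
      split_ifs at h
    | oddDown β =>
      have := (oddFar_eq_side_iff.1 h).2
      rw [level_inj he.1 (by omega)] at this
      rw [this]
    | evenUp β => simp [Edge.src] at h
    | evenDown β => simp [Edge.src] at h
    | extra α β => simp [Edge.src] at h
  · rintro rfl
    exact oddFar_eq_side_iff.2 ⟨hα, rfl⟩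

/-- The edges that start at the upper end of the edge `2α`. -/
theorem src_eq_upper_iff {e : Edge} (he : IsEdge r m e) {α : ℕ} (hα : 1 ≤ α) (hr : α ≤ r) :
    e.src r m = .spine (level r m α + 1) ↔ e = .oddUp (α + 1) ∨
      (e = .evenUp (α + 1) ∧ ¬Ascending r m α) ∨ e = .evenDown α ∨ ∃ γ, e = .extra γ α := by
  constructor
  · intro h
    cases e with
    | oddUp β =>
      rcases exists_oddNear_eq (m := m) he.1 he.2 with ⟨rfl, h'⟩ | ⟨δ, rfl, h1, h2, h'⟩
      · simp [Edge.src, h'] at h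
      · simp only [Edge.src, h', Vertex.spine.injEq, Nat.add_right_cancel_iff] at h
        rw [level_inj h1 hα] at h
        simp [h]
    | oddDown β =>
      obtain ⟨h1, h2⟩ := oddFar_eq_spine_iff.1 h
      obtain ⟨rfl, h3⟩ := (level_eq_level_add_one hα he.1).1 h2
      exact absurd ((horizontal_succ_iff hα hr).2 h3) h1
    | evenUp β =>
      simp only [Edge.src, Vertex.spine.injEq] at h
      obtain ⟨rfl, h3⟩ := (level_eq_level_add_one hα he.1).1 h
      simp [h3]
    | evenDown β =>
      simp only [Edge.src, Vertex.spine.injEq, Nat.add_right_cancel_iff] at h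
      rw [level_inj he.1 hα] at h
      simp [h]
    | extra γ β =>
      simp only [Edge.src, Vertex.spine.injEq, Nat.add_right_cancel_iff] at h
      have h1 := he.1
      have h2 := he.2.1
      rw [level_inj (by omega) hα] at h
      simp [h]
  · rintro (rfl | ⟨rfl, h⟩ | rfl | ⟨γ, rfl⟩)
    · exact oddNear_succ hα hr
    · simp only [Edge.src]
      rw [(level_eq_level_add_one hα (by omega)).2 ⟨rfl, h⟩]
    · rfl
    · rfl

theorem pathSum_root_succ (R : ℕ → ℤ → K) (n : ℕ) :
    pathSum r m R (.spine 0) (n + 1) = pathSum r m R (.spine (level r m 1)) (n + 1) := by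
  rw [pathSum_eq_sum R (O := {.oddUp 1}) ?_ (by simp)]
  · simp [Edge.down, Edge.weight, Edge.tgt, oddFar, not_horizontal_one]
  · intro e
    rw [Finset.mem_singleton]
    constructor
    · rintro rfl
      exact ⟨⟨le_rfl, by omega⟩, oddNear_one⟩
    · rintro ⟨h1, h2⟩
      exact (src_eq_root_iff h1).1 h2

/-- The hypothesis `hA` keeps this vertex apart from the upper end of the preceding even edge; if
they coincide, `pathSum_upper_succ` applies instead. -/
theorem pathSum_lower_succ (R : ℕ → ℤ → K) {α : ℕ} (hα : 1 ≤ α) (hr : α ≤ r)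
    (hA : ∀ δ, 1 ≤ δ → δ ≤ r → α = δ + 1 → Ascending r m δ) (n : ℕ) :
    pathSum r m R (.spine (level r m α)) (n + 1) =
      pathSum r m R (.spine (level r m α + 1)) (n + 1) +
        yOdd m R α * pathSum r m R (oddNear r m α) n := by
  classical
  rw [pathSum_eq_sum R (O := {.evenUp α, .oddDown α}) ?_ (by simp)]
  · rw [Finset.sum_pair (by simp)]
    simp [Edge.down, Edge.weight, Edge.tgt]
  · intro e
    rw [Finset.mem_insert, Finset.mem_singleton]
    constructor
    · intro h
      have he : IsEdge r m e := by
        rcases h with rfl | rfl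
        exacts [⟨hα, hr⟩, ⟨hα, by omega⟩]
      exact ⟨he, (src_eq_lower_iff he hα hA).2 h⟩
    · rintro ⟨h1, h2⟩
      exact (src_eq_lower_iff h1 hα hA).1 h2

theorem pathSum_top_succ (R : ℕ → ℤ → K) (n : ℕ) :
    pathSum r m R (.spine (level r m (r + 1))) (n + 1) =
        yOdd m R (r + 1) * pathSum r m R (oddNear r m (r + 1)) n := by
  have hA : ∀ δ, 1 ≤ δ → δ ≤ r → r + 1 = δ + 1 → Ascending r m δ :=
    fun δ _ _ h => Or.inl (by omega)
  rw [pathSum_eq_sum R (O := {.oddDown (r + 1)}) ?_ (by simp)]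
  · simp [Edge.down, Edge.weight, Edge.tgt]
  · intro e
    rw [Finset.mem_singleton]
    constructor
    · rintro rfl
      have he : IsEdge r m (.oddDown (r + 1)) := ⟨by omega, le_rfl⟩
      exact ⟨he, (src_eq_lower_iff he (by omega) hA).2 (Or.inr rfl)⟩
    · rintro ⟨h1, h2⟩
      rcases (src_eq_lower_iff h1 (by omega) hA).1 h2 with rfl | rfl
      · have := h1.2
        omega
      · rfl

theorem pathSum_side_succ (R : ℕ → ℤ → K) {α : ℕ} (hα : Horizontal r m α) (n : ℕ) :
    pathSum r m R (.side (level r m α)) (n + 1) =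
      yOdd m R α * pathSum r m R (oddNear r m α) n := by
  rw [pathSum_eq_sum R (O := {.oddDown α}) ?_ (by simp)]
  · simp [Edge.down, Edge.weight, Edge.tgt]
  · intro e
    rw [Finset.mem_singleton]
    constructor
    · rintro rfl
      have h1 := hα.1
      have h2 := hα.2.1
      have he : IsEdge r m (.oddDown α) := ⟨by omega, by omega⟩
      exact ⟨he, (src_eq_side_iff he hα).2 rfl⟩
    · rintro ⟨h1, h2⟩
      exact (src_eq_side_iff h1 hα).1 h2

/-- The recursion at the upper end of an even edge, in terms of the ends of the even edges
alone. -/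
theorem pathSum_upper_succ (R : ℕ → ℤ → K) {α : ℕ} (hα : 1 ≤ α) (hr : α ≤ r) (n : ℕ) :
    pathSum r m R (.spine (level r m α + 1)) (n + 1) =
      (if α = r then 0 else pathSum r m R (.spine (level r m (α + 1) + 1)) (n + 1)) +
      yOdd m R (α + 1) * pathSum r m R (.spine (level r m α + 1)) n +
      descentSum m R (fun γ => pathSum r m R (.spine (level r m γ)) n) α := by
  classical
  have hup : IsEdge r m (.oddUp (α + 1)) := ⟨by omega, by omega⟩
  have hd : Edge.oddUp (α + 1) ∉ descents m α := fun h => by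
    simpa using ((mem_descents hα hr).1 h).2
  -- If the odd edge is vertical, its upper vertex is eliminated: from there a path climbs the next
  -- even edge (unless `α = r`) or returns with weight `yOdd`. If it is horizontal, the same two
  -- terms come from the next even edge and from the excursion to the side vertex.
  by_cases hA : Ascending r m α
  · rw [pathSum_eq_sum R (O := insert (.oddUp (α + 1)) (descents m α)) ?_ (by simp)]
    · rw [Finset.sum_insert hd, sum_descents]
      congr 1
      have hH : ¬Horizontal r m (α + 1) := by
        rw [horizontal_succ_iff hα hr]
        exact not_not.2 hA
      simp only [Edge.down, Edge.weight, Edge.tgt, zero_le, if_true, one_mul, Nat.sub_zero,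
        oddFar, if_neg hH]
      split_ifs with h
      · subst h
        rw [pathSum_top_succ, oddNear_succ hα le_rfl, zero_add]
      · rw [pathSum_lower_succ R (by omega) (by omega), oddNear_succ hα hr]
        intro δ _ _ h
        obtain rfl : δ = α := by omega
        exact hA
    · intro e
      rw [Finset.mem_insert, mem_descents hα hr]
      constructor
      · rintro (rfl | ⟨h1, h2⟩)
        · exact ⟨hup, (src_eq_upper_iff hup hα hr).2 (Or.inl rfl)⟩
        · exact ⟨h1, (src_eq_upper_iff h1 hα hr).2 (Or.inr (Or.inr h2))⟩
      · rintro ⟨h1, h2⟩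
        rcases (src_eq_upper_iff h1 hα hr).1 h2 with h | ⟨_, h⟩ | h
        · exact Or.inl h
        · exact absurd hA h
        · exact Or.inr ⟨h1, h⟩
  · have hr' : α ≠ r := fun h => hA (Or.inl h)
    have hup' : IsEdge r m (.evenUp (α + 1)) := ⟨by omega, by omega⟩
    have hd' : Edge.evenUp (α + 1) ∉ descents m α := fun h => by
      simpa using ((mem_descents hα hr).1 h).2
    rw [pathSum_eq_sum R (O := insert (.oddUp (α + 1)) (insert (.evenUp (α + 1))
      (descents m α))) ?_ (by simp)]
    · rw [Finset.sum_insert (by simp [hd]), Finset.sum_insert hd', sum_descents, if_neg hr',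
        ← add_assoc]
      congr 1
      have hH : Horizontal r m (α + 1) := (horizontal_succ_iff hα hr).2 hA
      simp only [Edge.down, Edge.weight, Edge.tgt, zero_le, if_true, one_mul, Nat.sub_zero,
        oddFar, if_pos hH]
      rw [pathSum_side_succ R hH, oddNear_succ hα hr, add_comm]
    · intro e
      rw [Finset.mem_insert, Finset.mem_insert, mem_descents hα hr]
      constructor
      · rintro (rfl | rfl | ⟨h1, h2⟩)
        · exact ⟨hup, (src_eq_upper_iff hup hα hr).2 (Or.inl rfl)⟩
        · exact ⟨hup', (src_eq_upper_iff hup' hα hr).2 (Or.inr (Or.inl ⟨rfl, hA⟩))⟩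
        · exact ⟨h1, (src_eq_upper_iff h1 hα hr).2 (Or.inr (Or.inr h2))⟩
      · rintro ⟨h1, h2⟩
        rcases (src_eq_upper_iff h1 hα hr).1 h2 with h | ⟨h, _⟩ | h
        · exact Or.inl h
        · exact Or.inr (Or.inl h)
        · exact Or.inr (Or.inr ⟨h1, h⟩)

end Recursion

/-! ### Evaluation of the partition functions -/

section Evaluation

variable {r : ℕ} {m : ℕ → ℤ} {K : Type*} [Field K] {Q : ℕ → ℤ → K}

theorem IsExtendedSolution.lam_ne_zero (h : IsExtendedSolution r Q) {α : ℕ} (hα : α ≤ r + 1)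
    (n : ℤ) : lam Q α n ≠ 0 :=
  div_ne_zero (h.ne_zero α hα _) (h.ne_zero α hα _)

theorem IsExtendedSolution.lam_left (h : IsExtendedSolution r Q) (n : ℤ) : lam Q 0 n = 1 := by
  simp [lam, h.left]

theorem IsExtendedSolution.lam_right (h : IsExtendedSolution r Q) (n : ℤ) :
    lam Q (r + 1) n = 1 := by
  simp [lam, h.right]

theorem raiseCoeff_eq_lam_div_lam (Q : ℕ → ℤ → K) (a : ℕ) (n : ℤ) :
    raiseCoeff Q a n = lam Q (a + 1) n / lam Q a (n - 1) := by
  rw [raiseCoeff, lam, lam, sub_add_cancel, div_div_div_eq, mul_comm (Q a n)]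

/-- Odd weights are `raiseCoeff` after an ascending step (`raiseCoeff_eq_lam_div_lam`) and this
difference after a flat one. -/
theorem IsExtendedSolution.raiseCoeff_sub_shiftCoeff (h : IsExtendedSolution r Q) {a : ℕ}
    (ha : a ≤ r) (n : ℤ) : raiseCoeff Q a n - shiftCoeff Q a n =
      lam Q (a + 1) (n - 1) / lam Q a (n - 1) := by
  have h0 := h.ne_zero a (by omega)
  have h1 := h.ne_zero (a + 1) (by omega)
  have e := h.rel a ha n
  have := h0 n; have := h0 (n - 1); have := h1 n; have := h1 (n - 1)
  simp only [raiseCoeff, shiftCoeff, lam, sub_add_cancel]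
  field_simp
  linear_combination e

/-- The factor of `yEven` that does not involve the preceding step. -/
def descentCoeff (m : ℕ → ℤ) (Q : ℕ → ℤ → K) (α : ℕ) : K :=
  mu Q (α + 1) (m α + 1) / mu Q α (m α) *
    (if m α = m (α + 1) + 1 then lam Q (α + 1) (m (α + 1)) / lam Q (α + 1) (m α) else 1)

theorem mu_div_mu (Q : ℕ → ℤ → K) (a : ℕ) (n : ℤ) :
    mu Q (a + 2) (n + 1) / mu Q (a + 1) n = shiftCoeff Q a (n + 1) := by
  simp only [mu, shiftCoeff, add_sub_cancel_right, Nat.add_sub_cancel,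
    show a + 2 - 1 = a + 1 from rfl]
  rw [div_div_div_eq, mul_comm (Q (a + 1) (n + 1))]

/-- The moment counterpart of `pathSum_upper_succ`: the left side is the value that the descent sum
must take for the moments to satisfy the path recursion. -/
theorem IsExtendedSolution.descentCoeff_mul_moment (h : IsExtendedSolution r Q) {a : ℕ}
    (ha : a + 1 ≤ r) (hm : a + 1 < r → |m (a + 1) - m (a + 2)| ≤ 1) (k : ℤ) :
    descentCoeff m Q (a + 1) * moment Q a (m (a + 1)) (k + 1) =
      moment Q (a + 1) (m (a + 1)) (k + 1) -
        (if a + 1 = r then 0 else moment Q (a + 2) (m (a + 2)) k) -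
        yOdd m Q (a + 2) * moment Q (a + 1) (m (a + 1)) k := by
  have d : ∀ b n k, moment Q (b + 1) n k =
    moment Q b n (k + 1) - raiseCoeff Q b n * moment Q b (n - 1) k := fun _ _ _ => rfl
  set M := m (a + 1) with hM
  have s1 := h.moment_shift (a := a) (by omega) (M + 1) (k + 1)
  have r1 := d (a + 1) (M + 1) k
  rw [add_sub_cancel_right] at s1 r1
  rw [descentCoeff, ← hM, mu_div_mu]
  -- At the end of the graph the missing next vertex corresponds to `moment_top`, and the last odd
  -- weight is again a `raiseCoeff`.
  by_cases hr : a + 1 = r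
  · subst hr
    have t := h.moment_top (M + 1) k
    have hy : yOdd m Q (a + 2) = raiseCoeff Q (a + 1) (M + 1) := by
      rw [raiseCoeff_eq_lam_div_lam, yOdd, show a + 2 - 1 = a + 1 from rfl, h.lam_right,
        h.lam_right, add_sub_cancel_right]
    simp only [show a + 1 + 1 = a + 2 from rfl] at *
    simp only [if_true, hy, h.lam_right, div_one, ite_self, mul_one]
    linear_combination s1 + r1 - t
  · have hm := abs_le.1 (hm (by omega))
    simp only [show a + 1 + 1 = a + 2 from rfl] at *
    have s2 := h.moment_shift (a := a) (by omega) M k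
    have r2 := d (a + 1) M k
    have r3 := d a M k
    rw [if_neg hr, yOdd, show a + 2 - 1 = a + 1 from rfl, ← hM]
    rcases (by omega : m (a + 2) = M + 1 ∨ m (a + 2) = M ∨ m (a + 2) = M - 1) with h' | h' | h'
    -- Ascending step: the identity is one shift plus one raise at the window `M + 1`.
    · have hy := raiseCoeff_eq_lam_div_lam Q (a + 1) (M + 1)
      rw [add_sub_cancel_right] at hy
      rw [h', if_neg (by omega), ← hy]
      linear_combination s1 + r1
    -- Flat step: the odd weight is `raiseCoeff - shiftCoeff`, and the compatibility identities
    -- bring everything back to the window `M`.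
    · have i1 := h.shiftCoeff_succ ha (M + 1)
      have i2 := h.raiseCoeff_mul_shiftCoeff ha (M + 1)
      have i3 := h.raiseCoeff_sub_shiftCoeff (a := a + 1) (by omega) (M + 1)
      rw [add_sub_cancel_right] at i1 i2 i3
      rw [h', if_neg (by omega), ← i3]
      linear_combination r2 - moment Q (a + 1) M k * i1 + raiseCoeff Q (a + 1) M * s2 -
        shiftCoeff Q a (M + 1) * r3 - moment Q a (M - 1) k * i2
    -- Descending step: the next moment has window `M - 1`, and the bracket in `descentCoeff`
    -- supplies the correction; `hc` and `hs` match the coefficients.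
    · have i3 := h.raiseCoeff_sub_shiftCoeff (a := a + 1) (by omega) M
      have s3 := h.moment_shift (a := a + 1) (by omega) M k
      have hc : shiftCoeff Q a (M + 1) * (lam Q (a + 2) (M - 1) / lam Q (a + 2) M) =
          lam Q (a + 2) (M - 1) / lam Q (a + 1) (M - 1) -
            lam Q (a + 2) (M - 1) / lam Q (a + 1) M := by
        have h1 := h.ne_zero (a + 1) (by omega)
        have h2 := h.ne_zero (a + 2) (by omega)
        have e := h.rel a (by omega) M
        have := h1 M; have := h1 (M + 1); have := h1 (M - 1)
        have := h2 M; have := h2 (M + 1); have := h2 (M - 1)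
        simp only [shiftCoeff, lam, sub_add_cancel, add_sub_cancel_right]
        field_simp
        linear_combination -e
      have hs : lam Q (a + 2) (M - 1) / lam Q (a + 1) (M - 1) * shiftCoeff Q a M =
          shiftCoeff Q a (M + 1) * (lam Q (a + 2) (M - 1) / lam Q (a + 2) M) *
            raiseCoeff Q a M := by
        have h0 := h.ne_zero a (by omega)
        have h1 := h.ne_zero (a + 1) (by omega)
        have h2 := h.ne_zero (a + 2) (by omega)
        have := h1 M; have := h1 (M + 1); have := h1 (M - 1); have := h0 M
        have := h2 M; have := h2 (M + 1); have := h2 (M - 1)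
        simp only [shiftCoeff, raiseCoeff, lam, sub_add_cancel, add_sub_cancel_right]
        field_simp
      rw [h', if_pos (by omega)]
      linear_combination r2 - s3 - moment Q (a + 1) (M - 1) k * i3 + moment Q (a + 1) M k * hc +
        lam Q (a + 2) (M - 1) / lam Q (a + 1) (M - 1) * s2 -
        shiftCoeff Q a (M + 1) * (lam Q (a + 2) (M - 1) / lam Q (a + 2) M) * r3 -
        moment Q a (M - 1) k * hs

theorem IsExtendedSolution.yEven_eq (h : IsExtendedSolution r Q) {a : ℕ} (ha : a + 1 ≤ r)
    (hd : 1 ≤ a → m a ≠ m (a + 1) + 1) : yEven m Q (a + 1) = descentCoeff m Q (a + 1) := by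
  rw [yEven, descentCoeff, Nat.add_sub_cancel]
  rcases Nat.eq_zero_or_pos a with rfl | h0
  · simp [h.lam_left]
  · rw [if_neg (hd h0), mul_one]

theorem IsExtendedSolution.yEven_mul (h : IsExtendedSolution r Q) {a : ℕ} (ha : a + 1 ≤ r)
    (hd : m a = m (a + 1) + 1) : yEven m Q (a + 1) / yOdd m Q (a + 1) *
      (raiseCoeff Q a (m (a + 1) + 1) - shiftCoeff Q a (m (a + 1) + 1)) =
        descentCoeff m Q (a + 1) := by
  rw [h.raiseCoeff_sub_shiftCoeff (by omega), yEven, ← descentCoeff, yOdd, add_sub_cancel_right,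
    Nat.add_sub_cancel, if_pos hd]
  have h1 := h.lam_ne_zero (α := a) (by omega)
  have h2 := h.lam_ne_zero (α := a + 1) (by omega)
  have := h1 (m a); have := h1 (m (a + 1)); have := h2 (m (a + 1))
  field_simp

/-! ### Telescoping along a descending segment -/

theorem descendants_one : descendants m 1 = {1} := by
  ext γ
  rw [mem_descendants, Finset.mem_singleton]
  constructor
  · rintro ⟨h, _⟩
    omega
  · rintro rfl
    exact ⟨⟨le_rfl, le_rfl⟩, fun δ _ _ => by omega⟩

theorem descendants_succ {α : ℕ} : descendants m (α + 1) =
    insert (α + 1) (if m (α + 1) = m α - 1 then descendants m α else ∅) := by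
  ext γ
  rw [mem_descendants, Finset.mem_insert]
  constructor
  · rintro ⟨⟨h1, h2⟩, h3⟩
    rcases h2.eq_or_lt with rfl | h2
    · exact Or.inl rfl
    · right
      rw [if_pos (h3 α (by omega) (by omega)), mem_descendants]
      exact ⟨⟨h1, by omega⟩, fun δ h4 h5 => h3 δ h4 (by omega)⟩
  · rintro (rfl | h)
    · exact ⟨⟨by omega, le_rfl⟩, fun δ _ _ => by omega⟩
    · split_ifs at h with hd
      · obtain ⟨⟨h1, h2⟩, h3⟩ := mem_descendants.1 h
        refine ⟨⟨h1, by omega⟩, fun δ h4 h5 => ?_⟩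
        rcases (Nat.lt_succ_iff.1 h5).eq_or_lt with rfl | h5
        · exact hd
        · exact h3 δ h4 h5
      · simp at h

theorem weight_extra_self (R : ℕ → ℤ → K) (α : ℕ) :
    Edge.weight m R (.extra α α) = yEven m R α := by
  simp [Edge.weight]

theorem weight_extra_succ (R : ℕ → ℤ → K) {γ α : ℕ} (h : γ ≤ α) :
    Edge.weight m R (.extra γ (α + 1)) =
      yEven m R (α + 1) / yOdd m R (α + 1) * Edge.weight m R (.extra γ α) := by
  simp only [Edge.weight]
  rw [← Finset.insert_Icc_right_eq_Icc_add_one (by omega),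
    ← Finset.insert_Ioc_right_eq_Ioc_add_one h,
    Finset.prod_insert (by simp), Finset.prod_insert (by simp), div_mul_div_comm]

theorem descentSum_one (R : ℕ → ℤ → K) (f : ℕ → K) :
    descentSum m R f 1 = yEven m R 1 * f 1 := by
  rw [descentSum, descendants_one, Finset.sum_singleton, weight_extra_self]

theorem descentSum_succ (R : ℕ → ℤ → K) (f : ℕ → K) (α : ℕ) :
    descentSum m R f (α + 1) = yEven m R (α + 1) * f (α + 1) +
      if m (α + 1) = m α - 1 then yEven m R (α + 1) / yOdd m R (α + 1) * descentSum m R f α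
      else 0 := by
  rw [descentSum, descendants_succ, Finset.sum_insert, weight_extra_self]
  · congr 1
    split_ifs
    · rw [descentSum, Finset.mul_sum]
      refine Finset.sum_congr rfl fun γ hγ => ?_
      rw [weight_extra_succ R (mem_descendants.1 hγ).1.2, mul_assoc]
    · simp
  · split_ifs
    · intro h
      have := (mem_descendants.1 h).1.2
      omega
    · simp

/-- The value at the lower end of the edge `2 (a + 1)`. -/
def lowerMoment (m : ℕ → ℤ) (Q : ℕ → ℤ → K) (a : ℕ) (j : ℤ) : K :=
  -- After a flat or descending step this vertex is the upper end of the edge `2a`, whose window is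
  -- `m a`; the guard `1 ≤ a` avoids the meaningless `m 0`.
  moment Q a (if 1 ≤ a ∧ m a = m (a + 1) + 1 then m a else m (a + 1)) (j - a)

/-- In a descending segment, the new term `f` cancels the `yOdd` term of the preceding recursion.
What remains is a multiple of one moment by `raiseCoeff - shiftCoeff`, and `yEven_mul` turns the
factor into `descentCoeff`. -/
theorem IsExtendedSolution.descentSum_eq (h : IsExtendedSolution r Q)
    (hm : ∀ α, 1 ≤ α → α + 1 ≤ r → |m α - m (α + 1)| ≤ 1) {f : ℕ → K} {j : ℤ} {a : ℕ}
    (ha : a + 1 ≤ r) (hf : ∀ b, b + 1 ∈ descendants m (a + 1) → f (b + 1) = lowerMoment m Q b j) :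
    descentSum m Q f (a + 1) = descentCoeff m Q (a + 1) * moment Q a (m (a + 1)) (j - a) := by
  induction a with
  | zero =>
    rw [descentSum_one, h.yEven_eq ha (by omega), hf 0 (by simp [descendants_one]), lowerMoment,
      if_neg (by omega)]
  | succ a ih =>
    rw [descentSum_succ, hf (a + 1) (by simp [descendants_succ]), lowerMoment]
    by_cases hd : m (a + 1 + 1) = m (a + 1) - 1
    · have hd' : m (a + 1) = m (a + 1 + 1) + 1 := by omega
      rw [if_pos hd, if_pos ⟨by omega, hd'⟩, ih (by omega) fun b hb => hf b (by
        rw [descendants_succ, if_pos hd]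
        exact Finset.mem_insert_of_mem hb), ← h.yEven_mul ha hd']
      have e := h.descentCoeff_mul_moment (m := m) (a := a) (by omega) (fun _ => hm _ (by omega) ha)
        (j - (a + 1 : ℕ))
      rw [show j - ((a + 1 : ℕ) : ℤ) + 1 = j - a by push_cast; ring, if_neg (by omega)] at e
      rw [e]
      have s1 := h.moment_shift (a := a + 1) (by omega) (m (a + 1)) (j - (a + 1 : ℕ))
      have r1 : moment Q (a + 2) (m (a + 1)) (j - (a + 1 : ℕ)) = _ - _ := rfl
      rw [show j - ((a + 1 : ℕ) : ℤ) + 1 = j - a by push_cast; ring] at r1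
      have hy : yOdd m Q (a + 1 + 1) ≠ 0 :=
        div_ne_zero (h.lam_ne_zero (by omega) _) (h.lam_ne_zero (by simp; omega) _)
      simp only [show a + 1 + 1 = a + 2 from rfl] at *
      rw [show m (a + 2) = m (a + 1) - 1 from hd, sub_add_cancel]
      rw [s1] at r1
      generalize yOdd m Q (a + 2) = y at *
      field_simp
      linear_combination (-yEven m Q (a + 2)) * r1
    · rw [if_neg hd, if_neg (by omega), h.yEven_eq ha (by omega), add_zero]

end Evaluation

/-! ### The path formula, by induction on the number of down steps -/

section Formula

variable {r : ℕ} {m : ℕ → ℤ} {K : Type*} [Field K] {Q : ℕ → ℤ → K}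

/-- The number of down-pointing steps up to which the partition function of the upper end of the
edge `2α` vanishes. -/
def depth (m : ℕ → ℤ) (α : ℕ) : ℤ := m α - m 1 + α

theorem depth_one : depth m 1 = 1 := by simp [depth]

theorem depth_succ (α : ℕ) : depth m (α + 1) = depth m α + (m (α + 1) - m α) + 1 := by
  simp only [depth]
  push_cast
  ring

theorem one_le_depth (hm : ∀ α, 1 ≤ α → α + 1 ≤ r → |m α - m (α + 1)| ≤ 1) {α : ℕ} (hα : 1 ≤ α)
    (hr : α ≤ r) : 1 ≤ depth m α := by
  induction α, hα using Nat.le_induction with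
  | base => rw [depth_one]
  | succ α hα ih =>
    have := abs_le.1 (hm α hα hr)
    have := ih (by omega)
    rw [depth_succ]
    omega

/-- Along a descending segment the drop of `m` offsets the growth of the index, so the moment
formulas of all terms in a descent sum become available at the same `n`. -/
theorem depth_eq_of_mem_descendants {α γ : ℕ} (h : γ ∈ descendants m α) :
    depth m γ = depth m α := by
  obtain ⟨⟨_, h2⟩, h3⟩ := mem_descendants.1 h
  clear h
  induction α, h2 using Nat.le_induction with
  | base => rfl
  | succ α hα ih =>
    rw [ih fun δ h4 h5 => h3 δ h4 (by omega), depth_succ, h3 α hα (by omega)]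
    ring

/-- The values of the partition functions with `n` down-pointing steps at the root and at the
two ends of the even edges, up to the factor `Q 1 (m 1)`. -/
structure PathSumsEq (r : ℕ) (m : ℕ → ℤ) (Q : ℕ → ℤ → K) (n : ℕ) : Prop where
  root : Q 1 (m 1) * pathSum r m Q (.spine 0) n = Q 1 (n + m 1)
  upper_zero : ∀ α, 1 ≤ α → α ≤ r → (n : ℤ) ≤ depth m α →
    pathSum r m Q (.spine (level r m α + 1)) n = 0
  upper : ∀ α, 1 ≤ α → α ≤ r → depth m α ≤ n →
    Q 1 (m 1) * pathSum r m Q (.spine (level r m α + 1)) n = moment Q α (m α) (n + m 1 - α)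
  lower_zero : ∀ α, 1 ≤ α → α ≤ r → (n : ℤ) < depth m α →
    pathSum r m Q (.spine (level r m α)) n = 0
  lower : ∀ a, a + 1 ≤ r → depth m (a + 1) ≤ n →
    Q 1 (m 1) * pathSum r m Q (.spine (level r m (a + 1))) n = lowerMoment m Q a (n + m 1)

theorem pathSumsEq_zero (hm : ∀ α, 1 ≤ α → α + 1 ≤ r → |m α - m (α + 1)| ≤ 1) :
    PathSumsEq r m Q 0 where
  root := by simp [pathSum_root_zero]
  upper_zero α _ _ _ := pathSum_zero_of_height_ne_zero Q (by simp [Vertex.height])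
  upper α h1 h2 h3 := by
    have := one_le_depth hm h1 h2
    push_cast at h3
    omega
  lower_zero α h1 _ _ := pathSum_zero_of_height_ne_zero Q (by
    have := one_le_level (r := r) (m := m) h1
    simp only [Vertex.height]
    omega)
  lower a h2 h3 := by
    have := one_le_depth hm (by omega) h2
    push_cast at h3
    omega

theorem mul_descentSum (R : ℕ → ℤ → K) (c : K) (f : ℕ → K) (α : ℕ) :
    c * descentSum m R f α = descentSum m R (fun γ => c * f γ) α := by
  simp only [descentSum, Finset.mul_sum]
  exact Finset.sum_congr rfl fun γ _ => by ring

theorem IsExtendedSolution.upper_succ_of_next (h : IsExtendedSolution r Q)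
    (hm : ∀ α, 1 ≤ α → α + 1 ≤ r → |m α - m (α + 1)| ≤ 1) {n : ℕ} (ih : PathSumsEq r m Q n)
    {α : ℕ} (hα : 1 ≤ α) (hr : α ≤ r) (next : α < r →
    ((n : ℤ) + 1 ≤ depth m (α + 1) →
      pathSum r m Q (.spine (level r m (α + 1) + 1)) (n + 1) = 0) ∧
    (depth m (α + 1) ≤ (n : ℤ) + 1 →
      Q 1 (m 1) * pathSum r m Q (.spine (level r m (α + 1) + 1)) (n + 1) =
        moment Q (α + 1) (m (α + 1)) (n + 1 + m 1 - (α + 1 : ℕ)))) :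
    ((n : ℤ) + 1 ≤ depth m α → pathSum r m Q (.spine (level r m α + 1)) (n + 1) = 0) ∧
    (depth m α ≤ (n : ℤ) + 1 →
      Q 1 (m 1) * pathSum r m Q (.spine (level r m α + 1)) (n + 1) =
        moment Q α (m α) (n + 1 + m 1 - α)) := by
  have hzero : (n : ℤ) + 1 ≤ depth m α →
      pathSum r m Q (.spine (level r m α + 1)) (n + 1) = 0 := by
    intro hn
    have hN : (if α = r then 0 else
        pathSum r m Q (.spine (level r m (α + 1) + 1)) (n + 1)) = 0 := by
      split_ifs with h'
      · rfl
      · have := abs_le.1 (hm α hα (by omega))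
        refine (next (by omega)).1 ?_
        rw [depth_succ]
        omega
    have hS : descentSum m Q (fun γ => pathSum r m Q (.spine (level r m γ)) n) α = 0 := by
      refine Finset.sum_eq_zero fun γ hγ => ?_
      have hd := depth_eq_of_mem_descendants hγ
      have h1 := (mem_descendants.1 hγ).1
      dsimp only
      rw [ih.lower_zero γ h1.1 (by omega) (by omega), mul_zero]
    rw [pathSum_upper_succ Q hα hr, hN, hS, ih.upper_zero α hα hr (by omega)]
    simp
  refine ⟨hzero, fun hn => ?_⟩
  -- At equality the moment index is `m α`, the end of the orthogonality window. Below it the path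
  -- sum is zero, but the moments need not be.
  rcases hn.eq_or_lt with hn | hn
  · rw [hzero hn.ge, mul_zero]
    symm
    apply h.moment_eq_zero (by omega) <;> simp only [depth] at hn <;> omega
  · have hN : Q 1 (m 1) * (if α = r then 0 else
        pathSum r m Q (.spine (level r m (α + 1) + 1)) (n + 1)) =
        if α = r then 0 else moment Q (α + 1) (m (α + 1)) (n + m 1 - α) := by
      split_ifs with h'
      · simp
      · have hs := abs_le.1 (hm α hα (by omega))
        have hd := depth_succ (m := m) α
        have hk : (n : ℤ) + m 1 - α = n + 1 + m 1 - (α + 1 : ℕ) := by push_cast; ring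
        rw [hk]
        by_cases hn' : depth m (α + 1) ≤ (n : ℤ) + 1
        · exact (next (by omega)).2 hn'
        -- This occurs only when the step ascends and `n + 1` is one short of the next depth; the
        -- index `m (α + 1) - 1` is still in the window.
        · rw [(next (by omega)).1 (by omega), mul_zero]
          symm
          apply h.moment_eq_zero (by omega) <;> simp only [depth] at * <;> push_cast at * <;>
            omega
    obtain ⟨a, rfl⟩ : ∃ a, α = a + 1 := ⟨α - 1, by omega⟩
    have hS := h.descentSum_eq hm (j := n + m 1) hr
      (f := fun γ => Q 1 (m 1) * pathSum r m Q (.spine (level r m γ)) n) (fun b hb => by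
        have hd := depth_eq_of_mem_descendants hb
        have h1 := (mem_descendants.1 hb).1
        exact ih.lower b (by omega) (by omega))
    have hk : (n : ℤ) + m 1 - a = n + m 1 - (a + 1 : ℕ) + 1 := by push_cast; ring
    rw [hk, h.descentCoeff_mul_moment hr (fun h' => hm _ hα h'), ← mul_descentSum] at hS
    have hB := ih.upper (a + 1) hα hr (by omega)
    rw [pathSum_upper_succ Q hα hr]
    rw [show (n : ℤ) + 1 + m 1 - (a + 1 : ℕ) = n + m 1 - (a + 1 : ℕ) + 1 by ring]
    simp only [show a + 1 + 1 = a + 2 from rfl] at *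
    linear_combination hN + hS + yOdd m Q (a + 2) * hB

/-- Induction runs downwards from `r`, because climbing to the next even edge does not consume a
down step. -/
theorem IsExtendedSolution.upper_succ (h : IsExtendedSolution r Q)
    (hm : ∀ α, 1 ≤ α → α + 1 ≤ r → |m α - m (α + 1)| ≤ 1) {n : ℕ} (ih : PathSumsEq r m Q n)
    {α : ℕ} (hα : 1 ≤ α) (hr : α ≤ r) :
    ((n : ℤ) + 1 ≤ depth m α → pathSum r m Q (.spine (level r m α + 1)) (n + 1) = 0) ∧
    (depth m α ≤ (n : ℤ) + 1 → Q 1 (m 1) * pathSum r m Q (.spine (level r m α + 1)) (n + 1) =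
      moment Q α (m α) (n + 1 + m 1 - α)) := by
  induction hj : r - α generalizing α with
  | zero => exact h.upper_succ_of_next hm ih hα hr fun _ => by omega
  | succ j ihj => exact h.upper_succ_of_next hm ih hα hr fun _ => ihj (by omega) (by omega) (by omega)

theorem IsExtendedSolution.pathSumsEq_succ (h : IsExtendedSolution r Q) (h0 : 1 ≤ r)
    (hm : ∀ α, 1 ≤ α → α + 1 ≤ r → |m α - m (α + 1)| ≤ 1) {n : ℕ} (ih : PathSumsEq r m Q n) :
    PathSumsEq r m Q (n + 1) := by
  have hroot : Q 1 (m 1) * pathSum r m Q (.spine 0) (n + 1) = Q 1 ((n : ℤ) + 1 + m 1) := by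
    have hB := (h.upper_succ hm ih le_rfl h0).2 (by rw [depth_one]; omega)
    rw [pathSum_root_succ, pathSum_lower_succ Q le_rfl h0 (by omega), oddNear_one]
    have hy : yOdd m Q 1 = raiseCoeff Q 0 (m 1) := by
      rw [raiseCoeff_eq_lam_div_lam, yOdd, h.lam_left, h.lam_left]
    have hr := ih.root
    simp only [moment, Nat.cast_one] at hB
    rw [show (n : ℤ) + 1 + m 1 - 1 + 1 = n + 1 + m 1 by ring,
      show (n : ℤ) + 1 + m 1 - 1 = n + m 1 by ring] at hB
    rw [hy]
    linear_combination hB + raiseCoeff Q 0 (m 1) * hr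
  refine ⟨by push_cast; exact hroot,
    fun α h1 h2 => by push_cast; exact (h.upper_succ hm ih h1 h2).1,
    fun α h1 h2 => by push_cast; exact (h.upper_succ hm ih h1 h2).2, ?_, ?_⟩
  · intro α h1 h2 h3
    push_cast at h3
    obtain ⟨a, rfl⟩ : ∃ a, α = a + 1 := ⟨α - 1, by omega⟩
    rcases Nat.eq_zero_or_pos a with rfl | ha
    · rw [zero_add, depth_one] at h3
      omega
    · have hs := abs_le.1 (hm a ha h2)
      have hd := depth_succ (m := m) a
      by_cases hA : Ascending r m a
      · rw [pathSum_lower_succ Q h1 h2, oddNear_succ ha (by omega),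
          (h.upper_succ hm ih h1 h2).1 h3.le, ih.upper_zero a ha (by omega)]
        · simp
        · have : m (a + 1) = m a + 1 := hA.resolve_left (by omega)
          omega
        · intro δ _ _ hδ
          obtain rfl : δ = a := by omega
          exact hA
      · rw [level_succ ha, if_neg hA]
        have : m (a + 1) ≠ m a + 1 := fun h' => hA (Or.inr h')
        exact (h.upper_succ hm ih ha (by omega)).1 (by omega)
  · intro a h2 h3
    push_cast at h3 ⊢
    rcases Nat.eq_zero_or_pos a with rfl | ha
    · rw [zero_add, ← pathSum_root_succ, hroot]
      simp [lowerMoment, moment]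
    · have hs := abs_le.1 (hm a ha h2)
      have hd := depth_succ (m := m) a
      rw [lowerMoment]
      by_cases hA : Ascending r m a
      · have hA' : m (a + 1) = m a + 1 := hA.resolve_left (by omega)
        rw [pathSum_lower_succ Q (by omega) h2, oddNear_succ ha (by omega), if_neg (by omega),
          mul_add, (h.upper_succ hm ih (by omega) h2).2 h3, mul_left_comm,
          ih.upper a ha (by omega) (by omega), moment, raiseCoeff_eq_lam_div_lam, yOdd,
          Nat.add_sub_cancel, hA', add_sub_cancel_right]
        · rw [show (n : ℤ) + 1 + m 1 - (a + 1 : ℕ) + 1 = n + 1 + m 1 - a by push_cast; ring,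
            show (n : ℤ) + 1 + m 1 - (a + 1 : ℕ) = n + m 1 - a by push_cast; ring]
          ring
        · intro δ _ _ hδ
          obtain rfl : δ = a := by omega
          exact hA
      · have hA' : m (a + 1) ≠ m a + 1 := fun h' => hA (Or.inr h')
        rw [level_succ ha, if_neg hA, (h.upper_succ hm ih ha (by omega)).2 (by omega)]
        congr 1
        split_ifs <;> omega

theorem IsExtendedSolution.pathSumsEq (h : IsExtendedSolution r Q) (h0 : 1 ≤ r)
    (hm : ∀ α, 1 ≤ α → α + 1 ≤ r → |m α - m (α + 1)| ≤ 1) (n : ℕ) : PathSumsEq r m Q n := by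
  induction n with
  | zero => exact pathSumsEq_zero hm
  | succ n ih => exact h.pathSumsEq_succ h0 hm ih

/-! ### The path formula for an arbitrary solution -/

/-- Continuation of a solution by `0` above `α = r + 1`. -/
def extend (r : ℕ) (R : ℕ → ℤ → K) (α : ℕ) (n : ℤ) : K := if α ≤ r + 1 then R α n else 0

theorem extend_of_le (R : ℕ → ℤ → K) {α : ℕ} (h : α ≤ r + 1) : extend r R α = R α :=
  funext fun _ => if_pos h

theorem IsSolution.ne_zero {R : ℕ → ℤ → K} (hR : IsSolution r R) (hn : Nonvanishing r R) {α : ℕ}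
    (hα : α ≤ r + 1) (n : ℤ) : R α n ≠ 0 := by
  rcases Nat.eq_zero_or_pos α with rfl | h0
  · rw [hR.left]
    exact one_ne_zero
  · rcases hα.eq_or_lt with rfl | h
    · rw [hR.right]
      exact one_ne_zero
    · exact hn α h0 (by omega) n

/-- The additional relation at `α = r + 1` reads `1 = 1 + 0`. -/
theorem IsSolution.isExtendedSolution_extend {R : ℕ → ℤ → K} (hR : IsSolution r R)
    (hn : Nonvanishing r R) : IsExtendedSolution r (extend r R) where
  left n := by rw [extend_of_le R (by omega), hR.left]
  right n := by rw [extend_of_le R le_rfl, hR.right]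
  above n := if_neg (by omega)
  ne_zero α hα n := by
    rw [extend_of_le R hα]
    exact hR.ne_zero hn hα n
  rel α hα n := by
    rcases hα.eq_or_lt with rfl | h
    · rw [extend_of_le R le_rfl, hR.right, hR.right, hR.right, extend, if_neg (by omega)]
      ring
    · rw [extend_of_le R (by omega), extend_of_le R (by omega), extend_of_le R (by omega)]
      exact hR.rel (α + 1) (by omega) h n

theorem yOdd_extend (R : ℕ → ℤ → K) {α : ℕ} (h : α ≤ r + 1) :
    yOdd m (extend r R) α = yOdd m R α := by
  simp only [yOdd, lam, extend_of_le R h, extend_of_le R (show α - 1 ≤ r + 1 by omega)]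

theorem yEven_extend (R : ℕ → ℤ → K) {α : ℕ} (h : α ≤ r) :
    yEven m (extend r R) α = yEven m R α := by
  simp only [yEven, lam, mu, Nat.add_sub_cancel, extend_of_le R (show α ≤ r + 1 by omega),
    extend_of_le R (show α - 1 ≤ r + 1 by omega), extend_of_le R (show α + 1 ≤ r + 1 by omega)]

theorem weight_extend (R : ℕ → ℤ → K) {e : Edge} (he : IsEdge r m e) :
    e.weight m (extend r R) = e.weight m R := by
  cases e with
  | oddUp α => rfl
  | evenUp α => rfl
  | oddDown α => exact yOdd_extend R he.2
  | evenDown α => exact yEven_extend R he.2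
  | extra α β =>
    have hβ := he.2.2.1
    simp only [Edge.weight]
    congr 1
    · refine Finset.prod_congr rfl fun γ hγ => yEven_extend R ?_
      have := (Finset.mem_Icc.1 hγ).2
      omega
    · refine Finset.prod_congr rfl fun γ hγ => yOdd_extend R ?_
      have := (Finset.mem_Ioc.1 hγ).2
      omega

theorem IsPath.isEdge {l : List Edge} {a b : Vertex} (h : IsPath r m a l b) :
    ∀ e ∈ l, IsEdge r m e := by
  induction l generalizing a with
  | nil => simp
  | cons e l ih =>
    intro e' he'
    rcases List.mem_cons.1 he' with rfl | he'
    · exact h.1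
    · exact ih h.2.2 e' he'

theorem IsSolution.path_formula {R : ℕ → ℤ → K} (hR : IsSolution r R) (hn : Nonvanishing r R)
    (h0 : 1 ≤ r) (hm : ∀ α, 1 ≤ α → α + 1 ≤ r → |m α - m (α + 1)| ≤ 1) (n : ℕ) :
    R 1 (n + m 1) = R 1 (m 1) * pathZ r m R n := by
  have h := ((hR.isExtendedSolution_extend hn).pathSumsEq h0 hm n).root
  rw [extend_of_le R (by omega)] at h
  rw [← h]
  congr 1
  refine finsum_mem_congr rfl fun l hl => ?_
  rw [List.map_congr_left fun e he => weight_extend R (hl.1.isEdge e he)]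

end Formula

/-! ### Laurent monomials and Laurent polynomials in the seed -/

section Laurent

universe u

/-- `F` is a Laurent monomial in the seed, uniformly in the solution. -/
def IsSeedMonomial (r : ℕ) (m : ℕ → ℤ)
    (F : ∀ (K : Type u) [Field K], (ℕ → ℤ → K) → K) : Prop :=
  ∃ k : Fin r × Fin 2 → ℤ, ∀ (K : Type u) [Field K] (R : ℕ → ℤ → K),
    IsSolution r R → Nonvanishing r R → F K R = laurentMonomial (seed r m R) k

/-- `F` is a Laurent polynomial in the seed with non-negative integer coefficients, uniformly in
the solution. -/
def IsSeedPolynomial (r : ℕ) (m : ℕ → ℤ)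
    (F : ∀ (K : Type u) [Field K], (ℕ → ℤ → K) → K) : Prop :=
  ∃ P : PosLaurent r, ∀ (K : Type u) [Field K] (R : ℕ → ℤ → K),
    IsSolution r R → Nonvanishing r R → F K R = P.eval (seed r m R)

variable {r : ℕ} {m : ℕ → ℤ} {F G : ∀ (K : Type u) [Field K], (ℕ → ℤ → K) → K}

theorem seed_ne_zero {K : Type*} [Field K] {R : ℕ → ℤ → K} (hn : Nonvanishing r R)
    (p : Fin r × Fin 2) : seed r m R p ≠ 0 :=
  hn _ (by omega) (by omega) _

theorem IsSeedMonomial.congr (hF : IsSeedMonomial r m F)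
    (h : ∀ (K : Type u) [Field K] (R : ℕ → ℤ → K), IsSolution r R → Nonvanishing r R →
      G K R = F K R) : IsSeedMonomial r m G := by
  obtain ⟨k, hk⟩ := hF
  exact ⟨k, fun K _ R h1 h2 => by rw [h K R h1 h2, hk K R h1 h2]⟩

theorem IsSeedMonomial.one : IsSeedMonomial r m fun K _ _ => (1 : K) :=
  ⟨0, fun K _ R _ _ => by simp [laurentMonomial]⟩

theorem IsSeedMonomial.mul (hF : IsSeedMonomial r m F) (hG : IsSeedMonomial r m G) :
    IsSeedMonomial r m fun K _ R => F K R * G K R := by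
  obtain ⟨k, hk⟩ := hF
  obtain ⟨l, hl⟩ := hG
  refine ⟨k + l, fun K _ R h1 h2 => ?_⟩
  dsimp only
  rw [hk K R h1 h2, hl K R h1 h2]
  simp only [laurentMonomial]
  rw [← Finset.prod_mul_distrib]
  exact Finset.prod_congr rfl fun p _ => (zpow_add₀ (seed_ne_zero h2 p) _ _).symm

theorem IsSeedMonomial.inv (hF : IsSeedMonomial r m F) :
    IsSeedMonomial r m fun K _ R => (F K R)⁻¹ := by
  obtain ⟨k, hk⟩ := hF
  refine ⟨-k, fun K _ R h1 h2 => ?_⟩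
  dsimp only
  rw [hk K R h1 h2]
  simp [laurentMonomial]

theorem IsSeedMonomial.div (hF : IsSeedMonomial r m F) (hG : IsSeedMonomial r m G) :
    IsSeedMonomial r m fun K _ R => F K R / G K R :=
  (hF.mul hG.inv).congr fun _ _ _ _ _ => div_eq_mul_inv _ _

theorem IsSeedMonomial.prod {ι : Type*} (s : Finset ι)
    {F : ι → ∀ (K : Type u) [Field K], (ℕ → ℤ → K) → K}
    (hF : ∀ i ∈ s, IsSeedMonomial r m (F i)) :
    IsSeedMonomial r m fun K _ R => ∏ i ∈ s, F i K R := by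
  classical
  induction s using Finset.induction_on with
  | empty => exact IsSeedMonomial.one.congr fun _ _ _ _ _ => Finset.prod_empty
  | insert i s hi ih =>
    exact ((hF i (Finset.mem_insert_self i s)).mul
      (ih fun j hj => hF j (Finset.mem_insert_of_mem hj))).congr
        fun _ _ _ _ _ => Finset.prod_insert hi

theorem IsSeedMonomial.list_prod {ι : Type*} (l : List ι)
    {F : ι → ∀ (K : Type u) [Field K], (ℕ → ℤ → K) → K}
    (hF : ∀ i ∈ l, IsSeedMonomial r m (F i)) :
    IsSeedMonomial r m fun K _ R => (l.map fun i => F i K R).prod := by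
  induction l with
  | nil => exact IsSeedMonomial.one
  | cons i l ih =>
    exact ((hF i List.mem_cons_self).mul (ih fun j hj => hF j (List.mem_cons_of_mem i hj))).congr
      fun _ _ _ _ _ => by rw [List.map_cons, List.prod_cons]

theorem isSeedMonomial_apply {α : ℕ} (hα : α ≤ r + 1) {n : ℤ} (hn : n = m α ∨ n = m α + 1) :
    IsSeedMonomial r m fun _ _ R => R α n := by
  by_cases h : 1 ≤ α ∧ α ≤ r
  · obtain ⟨a, rfl⟩ : ∃ a, α = a + 1 := ⟨α - 1, by omega⟩
    have key : ∀ i : Fin 2, IsSeedMonomial r m fun _ _ R => R (a + 1) (m (a + 1) + (i.val : ℤ)) := by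
      intro i
      refine ⟨Pi.single (⟨a, by omega⟩, i) 1, fun K _ R h1 h2 => ?_⟩
      rw [laurentMonomial, Finset.prod_eq_single (⟨a, by omega⟩, i)]
      · simp [seed]
      · intro p _ hp
        simp [hp]
      · simp
    rcases hn with rfl | rfl
    · simpa using key 0
    · simpa using key 1
  · refine IsSeedMonomial.one.congr fun K _ R h1 h2 => ?_
    rcases (by omega : α = 0 ∨ α = r + 1) with rfl | rfl
    · exact h1.left n
    · exact h1.right n

theorem isSeedMonomial_lam {α : ℕ} (hα : α ≤ r + 1) :
    IsSeedMonomial r m fun _ _ R => lam R α (m α) :=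
  (isSeedMonomial_apply hα (Or.inr rfl)).div (isSeedMonomial_apply hα (Or.inl rfl))

theorem isSeedMonomial_yOdd {α : ℕ} (hα : α ≤ r + 1) :
    IsSeedMonomial r m fun _ _ R => yOdd m R α :=
  (isSeedMonomial_lam hα).div (isSeedMonomial_lam (α := α - 1) (by omega))

/-- The part of `yEven` that involves `R (α + 1)`. -/
theorem isSeedMonomial_next (hm : ∀ α, 1 ≤ α → α + 1 ≤ r → |m α - m (α + 1)| ≤ 1) {α : ℕ}
    (hα : 1 ≤ α) (hr : α ≤ r) : IsSeedMonomial r m fun _ _ R => R (α + 1) (m α + 1) *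
      (if m α = m (α + 1) + 1 then lam R (α + 1) (m (α + 1)) / lam R (α + 1) (m α) else 1) := by
  by_cases h : α = r
  · refine IsSeedMonomial.one.congr fun K _ R h1 h2 => ?_
    subst h
    simp [lam, h1.right]
  · have := abs_le.1 (hm α hα (by omega))
    -- Only here does `R (α + 1) (m α + 1)` leave the seed, being at `m (α + 1) + 2`; the bracket
    -- cancels it. In `isSeedMonomial_prev` the offending index is `m a - 1`.
    by_cases hd : m α = m (α + 1) + 1
    · have h1 := isSeedMonomial_apply (r := r) (m := m) (α := α + 1) (by omega) (Or.inr rfl)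
      refine ((isSeedMonomial_lam (r := r) (m := m) (α := α + 1) (by omega)).mul h1).congr
        fun K _ R e1 e2 => ?_
      rw [if_pos hd, lam, lam, hd]
      have hne := e1.ne_zero e2 (α := α + 1) (by omega)
      have := hne (m (α + 1)); have := hne (m (α + 1) + 1); have := hne (m (α + 1) + 1 + 1)
      field_simp
    · simp only [if_neg hd, mul_one]
      exact isSeedMonomial_apply (by omega) (by omega)

/-- The part of `yEven` that involves `R (α - 1)`. -/
theorem isSeedMonomial_prev (hm : ∀ α, 1 ≤ α → α + 1 ≤ r → |m α - m (α + 1)| ≤ 1) {α : ℕ}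
    (hα : 1 ≤ α) (hr : α ≤ r) : IsSeedMonomial r m fun _ _ R => R (α - 1) (m α) *
      (if m (α - 1) = m α + 1 then lam R (α - 1) (m α) / lam R (α - 1) (m (α - 1)) else 1) := by
  obtain ⟨a, rfl⟩ : ∃ a, α = a + 1 := ⟨α - 1, by omega⟩
  rw [Nat.add_sub_cancel]
  rcases Nat.eq_zero_or_pos a with rfl | ha
  · refine IsSeedMonomial.one.congr fun K _ R h1 h2 => ?_
    simp [lam, h1.left]
  · have := abs_le.1 (hm a ha hr)
    by_cases hd : m a = m (a + 1) + 1
    · have h1 := isSeedMonomial_apply (r := r) (m := m) (α := a) (by omega) (Or.inl rfl)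
      refine (h1.div (isSeedMonomial_lam (r := r) (m := m) (α := a) (by omega))).congr
        fun K _ R e1 e2 => ?_
      rw [if_pos hd, lam, lam, hd]
      have hne := e1.ne_zero e2 (α := a) (by omega)
      have := hne (m (a + 1)); have := hne (m (a + 1) + 1); have := hne (m (a + 1) + 1 + 1)
      field_simp
    · simp only [if_neg hd, mul_one]
      exact isSeedMonomial_apply (by omega) (by omega)

theorem isSeedMonomial_yEven (hm : ∀ α, 1 ≤ α → α + 1 ≤ r → |m α - m (α + 1)| ≤ 1) {α : ℕ}
    (hα : 1 ≤ α) (hr : α ≤ r) : IsSeedMonomial r m fun _ _ R => yEven m R α := by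
  refine (((isSeedMonomial_next hm hα hr).mul (isSeedMonomial_prev hm hα hr)).div
    ((isSeedMonomial_apply (r := r) (m := m) (α := α) (by omega) (Or.inl rfl)).mul
      (isSeedMonomial_apply (α := α) (by omega) (Or.inr rfl)))).congr fun K _ R e1 e2 => ?_
  have hne := e1.ne_zero e2 (α := α) (by omega)
  have hne' := e1.ne_zero e2 (α := α - 1) (by omega)
  have := hne (m α); have := hne (m α + 1); have := hne' (m α)
  simp only [yEven, mu, Nat.add_sub_cancel]
  rw [div_div_div_eq]
  ring

theorem isSeedMonomial_weight (hm : ∀ α, 1 ≤ α → α + 1 ≤ r → |m α - m (α + 1)| ≤ 1) {e : Edge}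
    (he : IsEdge r m e) : IsSeedMonomial r m fun _ _ R => e.weight m R := by
  cases e with
  | oddUp α => exact IsSeedMonomial.one
  | evenUp α => exact IsSeedMonomial.one
  | oddDown α => exact isSeedMonomial_yOdd he.2
  | evenDown α => exact isSeedMonomial_yEven hm he.1 he.2
  | extra α β =>
    have h1 := he.1
    have h2 := he.2.2.1
    refine (IsSeedMonomial.prod _ fun γ hγ => ?_).div (IsSeedMonomial.prod _ fun γ hγ => ?_)
    · have := Finset.mem_Icc.1 hγ
      exact isSeedMonomial_yEven hm (by omega) (by omega)
    · have := Finset.mem_Ioc.1 hγ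
      exact isSeedMonomial_yOdd (by omega)

theorem IsSeedMonomial.isSeedPolynomial (hF : IsSeedMonomial r m F) : IsSeedPolynomial r m F := by
  obtain ⟨k, hk⟩ := hF
  refine ⟨Finsupp.single k 1, fun K _ R h1 h2 => ?_⟩
  rw [hk K R h1 h2, PosLaurent.eval, Finsupp.sum_single_index] <;> simp

theorem IsSeedPolynomial.zero : IsSeedPolynomial r m fun K _ _ => (0 : K) :=
  ⟨0, fun K _ R _ _ => by simp [PosLaurent.eval]⟩

theorem IsSeedPolynomial.add (hF : IsSeedPolynomial r m F) (hG : IsSeedPolynomial r m G) :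
    IsSeedPolynomial r m fun K _ R => F K R + G K R := by
  classical
  obtain ⟨P, hP⟩ := hF
  obtain ⟨P', hP'⟩ := hG
  refine ⟨P + P', fun K _ R h1 h2 => ?_⟩
  dsimp only
  rw [hP K R h1 h2, hP' K R h1 h2, PosLaurent.eval, PosLaurent.eval, PosLaurent.eval,
    Finsupp.sum_add_index'] <;> intros <;> simp [add_mul]

theorem IsSeedPolynomial.sum {ι : Type*} (s : Finset ι)
    {F : ι → ∀ (K : Type u) [Field K], (ℕ → ℤ → K) → K}
    (hF : ∀ i ∈ s, IsSeedPolynomial r m (F i)) :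
    IsSeedPolynomial r m fun K _ R => ∑ i ∈ s, F i K R := by
  classical
  induction s using Finset.induction_on with
  | empty => simpa using IsSeedPolynomial.zero
  | insert i s hi ih =>
    simp only [Finset.sum_insert hi]
    exact (hF i (Finset.mem_insert_self i s)).add
      (ih fun j hj => hF j (Finset.mem_insert_of_mem hj))

theorem finite_rootPaths (n : ℕ) : (rootPaths r m n).Finite := finite_pathsToRoot (.spine 0) n

theorem isSeedPolynomial_pathZ (hm : ∀ α, 1 ≤ α → α + 1 ≤ r → |m α - m (α + 1)| ≤ 1)
    (n : ℕ) : IsSeedPolynomial r m fun _ _ R => R 1 (m 1) * pathZ r m R n := by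
  have h : IsSeedPolynomial r m fun _ _ R => ∑ l ∈ (finite_rootPaths (r := r) (m := m) n).toFinset,
      R 1 (m 1) * (l.map (Edge.weight m R)).prod := by
    refine IsSeedPolynomial.sum _ fun l hl => IsSeedMonomial.isSeedPolynomial ?_
    rw [Set.Finite.mem_toFinset] at hl
    exact (isSeedMonomial_apply (by omega) (Or.inl rfl)).mul
      (IsSeedMonomial.list_prod l (F := fun e K _ R => Edge.weight m R e) fun e he =>
        isSeedMonomial_weight hm (hl.1.isEdge e he))
  obtain ⟨P, hP⟩ := h
  refine ⟨P, fun K _ R h1 h2 => ?_⟩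
  rw [← hP K R h1 h2]
  dsimp only
  rw [← Finset.mul_sum, pathZ, finsum_mem_eq_finite_toFinset_sum]

end Laurent

/-! ### The solution with an indeterminate seed -/

section Existence

variable {K : Type*} [Field K]

/-- A set of non-zero elements closed under addition, multiplication and division. -/
structure IsPositivity (P : K → Prop) : Prop where
  ne_zero : ∀ x, P x → x ≠ 0
  one : P 1
  add : ∀ x y, P x → P y → P (x + y)
  mul : ∀ x y, P x → P y → P (x * y)
  div : ∀ x y, P x → P y → P (x / y)

/-- Forward evolution from the seed `s₀ α` at `m α` and `s₁ α` at `m α + 1`. -/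
def evolve (r : ℕ) (m : ℕ → ℕ) (s₀ s₁ : ℕ → K) : ℕ → ℕ → K
  | 0, α => if α = 0 ∨ r < α then 1 else s₀ α
  | 1, α => if α = 0 ∨ r < α then 1 else if 1 ≤ m α then s₀ α else s₁ α
  -- Before time `m α` the value `s₀ α` is mere filler, chosen to stay in the positivity set.
  | n + 2, α => if α = 0 ∨ r < α then 1 else if n + 2 ≤ m α then s₀ α else
      if n + 1 = m α then s₁ α else
        (evolve r m s₀ s₁ (n + 1) α ^ 2 +
          evolve r m s₀ s₁ (n + 1) (α + 1) * evolve r m s₀ s₁ (n + 1) (α - 1)) /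
        evolve r m s₀ s₁ n α

variable {r : ℕ} {m : ℕ → ℕ} {s₀ s₁ : ℕ → K}

theorem evolve_boundary {n α : ℕ} (h : α = 0 ∨ r < α) : evolve r m s₀ s₁ n α = 1 := by
  match n with
  | 0 => rw [evolve, if_pos h]
  | 1 => rw [evolve, if_pos h]
  | n + 2 => rw [evolve, if_pos h]

theorem evolve_self {α : ℕ} (h1 : 1 ≤ α) (h2 : α ≤ r) : evolve r m s₀ s₁ (m α) α = s₀ α := by
  have h : ¬(α = 0 ∨ r < α) := by omega
  rcases hn : m α with _ | _ | n
  · rw [evolve, if_neg h]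
  · rw [zero_add, evolve, if_neg h, if_pos (by omega)]
  · rw [evolve, if_neg h, if_pos (by omega)]

theorem evolve_self_succ {α : ℕ} (h1 : 1 ≤ α) (h2 : α ≤ r) :
    evolve r m s₀ s₁ (m α + 1) α = s₁ α := by
  have h : ¬(α = 0 ∨ r < α) := by omega
  rcases hn : m α with _ | n
  · rw [zero_add, evolve, if_neg h, if_neg (by omega)]
  · rw [evolve, if_neg h, if_neg (by omega), if_pos (by omega)]

theorem IsPositivity.evolve {P : K → Prop} (hP : IsPositivity P)
    (h₀ : ∀ α, 1 ≤ α → α ≤ r → P (s₀ α)) (h₁ : ∀ α, 1 ≤ α → α ≤ r → P (s₁ α)) (n α : ℕ) :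
    P (evolve r m s₀ s₁ n α) := by
  induction n using Nat.strong_induction_on generalizing α with
  | _ n ih =>
  by_cases h : α = 0 ∨ r < α
  · rw [evolve_boundary h]
    exact hP.one
  · have p₀ := h₀ α (by omega) (by omega)
    have p₁ := h₁ α (by omega) (by omega)
    match n with
    | 0 => rwa [QSystem.evolve, if_neg h]
    | 1 =>
      rw [QSystem.evolve, if_neg h]
      split_ifs <;> assumption
    | n + 2 =>
      rw [QSystem.evolve, if_neg h]
      split_ifs
      · exact p₀
      · exact p₁
      · rw [pow_two]
        exact hP.div _ _ (hP.add _ _ (hP.mul _ _ (ih _ (by omega) _) (ih _ (by omega) _))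
          (hP.mul _ _ (ih _ (by omega) _) (ih _ (by omega) _))) (ih _ (by omega) _)

/-- Solvability in the direction of increasing `n`. -/
theorem IsPositivity.exists_forward {P : K → Prop} (hP : IsPositivity P) {m : ℕ → ℤ} {c : ℤ}
    (hc : ∀ α, 1 ≤ α → α ≤ r → c ≤ m α)
    (h₀ : ∀ α, 1 ≤ α → α ≤ r → P (s₀ α)) (h₁ : ∀ α, 1 ≤ α → α ≤ r → P (s₁ α)) :
    ∃ U : ℕ → ℤ → K, (∀ α n, P (U α n)) ∧ (∀ n, U 0 n = 1) ∧ (∀ n, U (r + 1) n = 1) ∧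
      (∀ α, 1 ≤ α → α ≤ r → U α (m α) = s₀ α ∧ U α (m α + 1) = s₁ α) ∧
      ∀ α, 1 ≤ α → α ≤ r → ∀ n, m α < n →
        U α (n + 1) * U α (n - 1) = U α n ^ 2 + U (α + 1) n * U (α - 1) n := by
  set m' : ℕ → ℕ := fun α => (m α - c).toNat with hm'
  have hpos := fun n α => hP.evolve (m := m') h₀ h₁ n α
  refine ⟨fun α n => QSystem.evolve r m' s₀ s₁ (n - c).toNat α, fun α n => hpos _ _,
    fun n => evolve_boundary (Or.inl rfl), fun n => evolve_boundary (Or.inr (by omega)), ?_, ?_⟩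
  · intro α h1 h2
    have := hc α h1 h2
    refine ⟨evolve_self (m := m') h1 h2, ?_⟩
    dsimp only
    rw [show (m α + 1 - c).toNat = m' α + 1 by simp only [hm']; omega]
    exact evolve_self_succ h1 h2
  · intro α h1 h2 n hn
    have := hc α h1 h2
    obtain ⟨k, hk⟩ : ∃ k : ℕ, (n - 1 - c).toNat = k := ⟨_, rfl⟩
    dsimp only
    rw [hk, show (n - c).toNat = k + 1 by omega, show (n + 1 - c).toNat = k + 2 by omega]
    have hmk : m' α ≤ k := by simp only [hm']; omega
    rw [QSystem.evolve, if_neg (by omega), if_neg (by omega), if_neg (by omega),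
      div_mul_cancel₀ _ (hP.ne_zero _ (hpos _ _))]

/-- Solvability in both directions. -/
theorem IsPositivity.exists_solution {P : K → Prop} (hP : IsPositivity P) {m : ℕ → ℤ}
    (hm : ∀ α, 1 ≤ α → α + 1 ≤ r → |m α - m (α + 1)| ≤ 1) {c d : ℤ}
    (hc : ∀ α, 1 ≤ α → α ≤ r → c ≤ m α) (hd : ∀ α, 1 ≤ α → α ≤ r → m α ≤ d)
    (h₀ : ∀ α, 1 ≤ α → α ≤ r → P (s₀ α)) (h₁ : ∀ α, 1 ≤ α → α ≤ r → P (s₁ α)) :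
    ∃ R : ℕ → ℤ → K, IsSolution r R ∧ Nonvanishing r R ∧
      ∀ α, 1 ≤ α → α ≤ r → R α (m α) = s₀ α ∧ R α (m α + 1) = s₁ α := by
  obtain ⟨U, u1, u2, u3, u4, u5⟩ := hP.exists_forward hc h₀ h₁
  -- The relations are invariant under `n ↦ -n`. The reflected seed sits at `-m α - 1` and `-m α`,
  -- so its two halves are swapped.
  obtain ⟨V, v1, v2, v3, v4, v5⟩ := hP.exists_forward (m := fun α => -m α - 1) (c := -d - 1)
    (fun α h1 h2 => by have := hd α h1 h2; omega) h₁ h₀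
  set R : ℕ → ℤ → K := fun α n => if m α ≤ n then U α n else V α (-n) with hR
  have R0 : ∀ n, R 0 n = 1 := fun n => by simp [hR, u2, v2]
  have Rr : ∀ n, R (r + 1) n = 1 := fun n => by simp [hR, u3, v3]
  have RU : ∀ α n, m α ≤ n → R α n = U α n := fun α n h => if_pos h
  have RV : ∀ α, 1 ≤ α → α ≤ r → ∀ n, n ≤ m α + 1 → R α n = V α (-n) := by
    intro α h1 h2 n hn
    by_cases h : m α ≤ n
    · rw [RU α n h]
      rcases (by omega : n = m α ∨ n = m α + 1) with rfl | rfl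
      · rw [(u4 α h1 h2).1, ← (v4 α h1 h2).2]
        congr 1
        ring
      · rw [(u4 α h1 h2).2, ← (v4 α h1 h2).1]
        congr 1
        ring
    · exact if_neg h
  have RU' : ∀ α n, (1 ≤ α → α ≤ r → m α ≤ n) → α ≤ r + 1 → R α n = U α n := by
    intro α n h h'
    by_cases hα : 1 ≤ α ∧ α ≤ r
    · exact RU α n (h hα.1 hα.2)
    · rcases (by omega : α = 0 ∨ α = r + 1) with rfl | rfl
      · rw [R0, u2]
      · rw [Rr, u3]
  have RV' : ∀ α n, (1 ≤ α → α ≤ r → n ≤ m α + 1) → α ≤ r + 1 → R α n = V α (-n) := by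
    intro α n h h'
    by_cases hα : 1 ≤ α ∧ α ≤ r
    · exact RV α hα.1 hα.2 n (h hα.1 hα.2)
    · rcases (by omega : α = 0 ∨ α = r + 1) with rfl | rfl
      · rw [R0, v2]
      · rw [Rr, v3]
  refine ⟨R, ⟨R0, Rr, ?_⟩, ?_, ?_⟩
  · intro α h1 h2 n
    have hnext : α + 1 ≤ r → m (α + 1) ≤ m α + 1 ∧ m α ≤ m (α + 1) + 1 := fun h => by
      have := abs_le.1 (hm α h1 h)
      omega
    have hprev : 1 ≤ α - 1 → m (α - 1) ≤ m α + 1 ∧ m α ≤ m (α - 1) + 1 := fun h => by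
      have := abs_le.1 (hm (α - 1) h (by omega))
      rw [Nat.sub_add_cancel h1] at this
      omega
    -- The Motzkin condition ensures that the neighbours at `n` lie in the same half, hence are
    -- genuine values and not filler. The halves overlap at `m α` and `m α + 1`, so the relation at
    -- `n = m α` can be read in the backward half.
    by_cases hn : m α < n
    · rw [RU α _ (by omega), RU α _ (by omega), RU α _ (by omega),
        RU' (α + 1) n (fun _ h => by have := hnext h; omega) (by omega),
        RU' (α - 1) n (fun h _ => by have := hprev h; omega) (by omega)]
      exact u5 α h1 h2 n hn
    · rw [RV α h1 h2 _ (by omega), RV α h1 h2 _ (by omega), RV α h1 h2 _ (by omega),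
        RV' (α + 1) n (fun _ h => by have := hnext h; omega) (by omega),
        RV' (α - 1) n (fun h _ => by have := hprev h; omega) (by omega),
        ← v5 α h1 h2 (-n) (by omega), mul_comm, neg_sub', neg_add']
      rfl
  · intro α _ _ n
    simp only [hR]
    split_ifs
    · exact hP.ne_zero _ (u1 α n)
    · exact hP.ne_zero _ (v1 α (-n))
  · intro α h1 h2
    rw [RU α _ le_rfl, RU α _ (by omega)]
    exact u4 α h1 h2

/-- A solution is determined by its seed as long as it agrees there with a non-vanishing one. -/
theorem IsSolution.eq_of_seed {R R' : ℕ → ℤ → K} (hR : IsSolution r R) (hn : Nonvanishing r R)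
    (hR' : IsSolution r R') {m : ℕ → ℤ}
    (hm : ∀ α, 1 ≤ α → α + 1 ≤ r → |m α - m (α + 1)| ≤ 1) {c d : ℤ}
    (hc : ∀ α, 1 ≤ α → α ≤ r → c ≤ m α) (hd : ∀ α, 1 ≤ α → α ≤ r → m α ≤ d)
    (hs : ∀ α, 1 ≤ α → α ≤ r → R' α (m α) = R α (m α) ∧ R' α (m α + 1) = R α (m α + 1))
    {α : ℕ} (hα : α ≤ r + 1) (n : ℤ) : R' α n = R α n := by
  have bdry : ∀ α, α ≤ r + 1 → ¬(1 ≤ α ∧ α ≤ r) → ∀ n, R' α n = R α n := by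
    intro α h h' n
    rcases (by omega : α = 0 ∨ α = r + 1) with rfl | rfl
    · rw [hR'.left, hR.left]
    · rw [hR'.right, hR.right]
  have fwd : ∀ k : ℕ, ∀ α, α ≤ r + 1 → (1 ≤ α → α ≤ r → m α ≤ c + k) →
      R' α (c + k) = R α (c + k) := by
    intro k
    induction k using Nat.strong_induction_on with
    | _ k ih =>
    intro α hα hk
    by_cases h : 1 ≤ α ∧ α ≤ r
    · obtain ⟨h1, h2⟩ := h
      have hk := hk h1 h2
      rcases (by omega : c + k = m α ∨ c + k = m α + 1 ∨ m α + 2 ≤ c + k) with h | h | h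
      · rw [h, (hs α h1 h2).1]
      · rw [h, (hs α h1 h2).2]
      · have := hc α h1 h2
        obtain ⟨j, rfl⟩ : ∃ j, k = j + 2 := ⟨k - 2, by omega⟩
        push_cast at h ⊢
        have e := hR.rel α h1 h2 (c + (j + 1 : ℕ))
        have e' := hR'.rel α h1 h2 (c + (j + 1 : ℕ))
        rw [ih (j + 1) (by omega) α hα (fun _ _ => by push_cast; omega),
          ih (j + 1) (by omega) (α + 1) (by omega) (fun _ h3 => by
            have := abs_le.1 (hm α h1 h3); push_cast; omega),
          ih (j + 1) (by omega) (α - 1) (by omega) (fun h3 _ => by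
            have := abs_le.1 (hm (α - 1) h3 (by omega))
            rw [Nat.sub_add_cancel h1] at this
            push_cast; omega),
          show c + ((j + 1 : ℕ) : ℤ) - 1 = c + j by push_cast; ring,
          ih j (by omega) α hα (fun _ _ => by omega), ← e,
          show c + ((j + 1 : ℕ) : ℤ) - 1 = c + j by push_cast; ring] at e'
        have := mul_right_cancel₀ (hn α h1 h2 _) e'
        rwa [show c + ((j + 1 : ℕ) : ℤ) + 1 = c + (j + 2) by push_cast; ring] at this
    · exact bdry α hα h _
  have bwd : ∀ k : ℕ, ∀ α, α ≤ r + 1 → (1 ≤ α → α ≤ r → d + 1 - k ≤ m α + 1) →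
      R' α (d + 1 - k) = R α (d + 1 - k) := by
    intro k
    induction k using Nat.strong_induction_on with
    | _ k ih =>
    intro α hα hk
    by_cases h : 1 ≤ α ∧ α ≤ r
    · obtain ⟨h1, h2⟩ := h
      have hk := hk h1 h2
      rcases (by omega : d + 1 - k = m α ∨ d + 1 - k = m α + 1 ∨ d + 1 - k + 1 ≤ m α)
        with h | h | h
      · rw [h, (hs α h1 h2).1]
      · rw [h, (hs α h1 h2).2]
      · have := hd α h1 h2
        obtain ⟨j, rfl⟩ : ∃ j, k = j + 2 := ⟨k - 2, by omega⟩
        push_cast at h ⊢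
        have e := hR.rel α h1 h2 (d + 1 - (j + 1 : ℕ))
        have e' := hR'.rel α h1 h2 (d + 1 - (j + 1 : ℕ))
        rw [ih (j + 1) (by omega) α hα (fun _ _ => by push_cast; omega),
          ih (j + 1) (by omega) (α + 1) (by omega) (fun _ h3 => by
            have := abs_le.1 (hm α h1 h3); push_cast; omega),
          ih (j + 1) (by omega) (α - 1) (by omega) (fun h3 _ => by
            have := abs_le.1 (hm (α - 1) h3 (by omega))
            rw [Nat.sub_add_cancel h1] at this
            push_cast; omega),
          show d + 1 - ((j + 1 : ℕ) : ℤ) + 1 = d + 1 - j by push_cast; ring,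
          ih j (by omega) α hα (fun _ _ => by omega), ← e,
          show d + 1 - ((j + 1 : ℕ) : ℤ) + 1 = d + 1 - j by push_cast; ring] at e'
        have := mul_left_cancel₀ (hn α h1 h2 _) e'
        rwa [show d + 1 - ((j + 1 : ℕ) : ℤ) - 1 = d + 1 - (j + 2) by push_cast; ring] at this
    · exact bdry α hα h _
  by_cases h : 1 ≤ α ∧ α ≤ r
  · have h1 := hc α h.1 h.2
    have h2 := hd α h.1 h.2
    by_cases hn : m α ≤ n
    · have := fwd (n - c).toNat α hα (fun _ _ => by omega)
      rwa [show c + ((n - c).toNat : ℤ) = n by omega] at this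
    · have := bwd (d + 1 - n).toNat α hα (fun _ _ => by omega)
      rwa [show d + 1 - ((d + 1 - n).toNat : ℤ) = n by omega] at this
  · exact bdry α hα h n

/-! ### Subtraction-free rational functions and the generic solution -/

/-- The inclusion of the polynomials with coefficients in `ℕ`. -/
noncomputable def ofNatPolynomial (r : ℕ) : MvPolynomial (Fin r × Fin 2) ℕ →+* SeedField r :=
  (algebraMap (MvPolynomial (Fin r × Fin 2) ℚ) (SeedField r)).comp
    (MvPolynomial.map (Nat.castRingHom ℚ))

/-- Evaluation at the all-ones point certifies non-vanishing; over `ℕ` this certificate survives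
sums and products. -/
theorem ofNatPolynomial_ne_zero {p : MvPolynomial (Fin r × Fin 2) ℕ}
    (hp : MvPolynomial.eval (fun _ => 1) p ≠ 0) : ofNatPolynomial r p ≠ 0 := by
  intro h
  rw [ofNatPolynomial, RingHom.comp_apply,
    (injective_iff_map_eq_zero' _).1 (IsFractionRing.injective _ (SeedField r))] at h
  have h' : p = 0 := MvPolynomial.map_injective (Nat.castRingHom ℚ) Nat.cast_injective
    (h.trans (map_zero _).symm)
  exact hp (by rw [h', map_zero])

/-- The elements with a subtraction-free expression. -/
def SubtractionFree (x : SeedField r) : Prop :=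
  ∃ p q : MvPolynomial (Fin r × Fin 2) ℕ, MvPolynomial.eval (fun _ => 1) p ≠ 0 ∧
    MvPolynomial.eval (fun _ => 1) q ≠ 0 ∧ x = ofNatPolynomial r p / ofNatPolynomial r q

theorem isPositivity_subtractionFree : IsPositivity (SubtractionFree (r := r)) where
  ne_zero := by
    rintro x ⟨p, q, hp, hq, rfl⟩
    exact div_ne_zero (ofNatPolynomial_ne_zero hp) (ofNatPolynomial_ne_zero hq)
  one := ⟨1, 1, by simp, by simp, by simp⟩
  add := by
    rintro x y ⟨p, q, hp, hq, rfl⟩ ⟨p', q', hp', hq', rfl⟩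
    refine ⟨p * q' + q * p', q * q', ?_, ?_, ?_⟩
    · rw [map_add, map_mul, map_mul]
      have := Nat.mul_ne_zero hp hq'
      omega
    · rw [map_mul]
      exact Nat.mul_ne_zero hq hq'
    · rw [div_add_div _ _ (ofNatPolynomial_ne_zero hq) (ofNatPolynomial_ne_zero hq')]
      simp
  mul := by
    rintro x y ⟨p, q, hp, hq, rfl⟩ ⟨p', q', hp', hq', rfl⟩
    refine ⟨p * p', q * q', ?_, ?_, ?_⟩
    · rw [map_mul]
      exact Nat.mul_ne_zero hp hp'
    · rw [map_mul]
      exact Nat.mul_ne_zero hq hq'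
    · rw [div_mul_div_comm]
      simp
  div := by
    rintro x y ⟨p, q, hp, hq, rfl⟩ ⟨p', q', hp', hq', rfl⟩
    refine ⟨p * q', q * p', ?_, ?_, ?_⟩
    · rw [map_mul]
      exact Nat.mul_ne_zero hp hq'
    · rw [map_mul]
      exact Nat.mul_ne_zero hq hp'
    · rw [div_div_div_eq]
      simp

theorem subtractionFree_seedVar (p : Fin r × Fin 2) : SubtractionFree (seedVar r p) :=
  ⟨MvPolynomial.X p, 1, by simp, by simp, by simp [ofNatPolynomial, seedVar]⟩

theorem exists_unique_solution {m : ℕ → ℤ} (hm : InFundamentalDomain r m) :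
    ∃ R : ℕ → ℤ → SeedField r, IsSolution r R ∧ Nonvanishing r R ∧ seed r m R = seedVar r ∧
      ∀ R' : ℕ → ℤ → SeedField r, IsSolution r R' → seed r m R' = seedVar r →
        ∀ α ≤ r + 1, ∀ n : ℤ, R' α n = R α n := by
  obtain ⟨d, hd⟩ : ∃ d : ℤ, ∀ α, 1 ≤ α → α ≤ r → m α ≤ d := by
    obtain ⟨d, hd⟩ := ((Finset.Icc 1 r).image m).exists_le
    exact ⟨d, fun α h1 h2 => hd _ (Finset.mem_image_of_mem m (Finset.mem_Icc.2 ⟨h1, h2⟩))⟩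
  set s : Fin 2 → ℕ → SeedField r := fun i α =>
    if h : α - 1 < r then seedVar r (⟨α - 1, h⟩, i) else 1 with hs
  have pos : ∀ i α, 1 ≤ α → α ≤ r → SubtractionFree (s i α) := by
    intro i α h1 h2
    simp only [hs]
    rw [dif_pos (by omega)]
    exact subtractionFree_seedVar _
  obtain ⟨R, h1, h2, h3⟩ := isPositivity_subtractionFree.exists_solution (r := r) hm.motzkin
    hm.nonneg hd (pos 0) (pos 1)
  have hseed : seed r m R = seedVar r := by
    funext ⟨a, i⟩
    have h4 := h3 (a + 1) (by omega) (by omega)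
    simp only [hs, Nat.add_sub_cancel, dif_pos a.isLt] at h4
    fin_cases i
    · simpa [seed] using h4.1
    · simpa [seed] using h4.2
  refine ⟨R, h1, h2, hseed, fun R' h1' hseed' α hα n => ?_⟩
  refine h1.eq_of_seed h2 h1' hm.motzkin hm.nonneg hd (fun α h3 h4 => ?_) hα n
  have key : ∀ i : Fin 2, R' α (m α + (i.val : ℤ)) = R α (m α + (i.val : ℤ)) := by
    intro i
    have := congrFun (hseed'.trans hseed.symm) (⟨α - 1, by omega⟩, i)
    simpa only [seed, Nat.sub_add_cancel h3] using this
  exact ⟨by simpa using key 0, by simpa using key 1⟩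

end Existence

end QSystem

theorem mainTheorem2 (r : ℕ) (m : ℕ → ℤ) (hm : QSystem.InFundamentalDomain r m) :
    -- there is exactly one solution whose seed `x_m` consists of `2 r` indeterminates
    -- (its entries are the functional forms `(R_{α,n})_m`), and none of its entries vanishes
    (∃ R : ℕ → ℤ → QSystem.SeedField r,
      QSystem.IsSolution r R ∧ QSystem.Nonvanishing r R ∧
      QSystem.seed r m R = QSystem.seedVar r ∧
      ∀ R' : ℕ → ℤ → QSystem.SeedField r, QSystem.IsSolution r R' →
        QSystem.seed r m R' = QSystem.seedVar r →
        ∀ α ≤ r + 1, ∀ n : ℤ, R' α n = R α n) ∧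
    -- there are finitely many paths from the root to itself with `n` down-pointing steps
    (∀ n : ℕ, (QSystem.rootPaths r m n).Finite) ∧
    -- the edge weights are Laurent monomials (with coefficient 1) in the seed `x_m`
    (∀ e : QSystem.Edge, QSystem.IsEdge r m e → ∃ k : Fin r × Fin 2 → ℤ,
      ∀ (K : Type*) [Field K] (R : ℕ → ℤ → K),
        QSystem.IsSolution r R → QSystem.Nonvanishing r R →
        e.weight m R = QSystem.laurentMonomial (QSystem.seed r m R) k) ∧
    -- the path formula, and positivity
    ∀ n : ℕ, ∃ P : QSystem.PosLaurent r,
      ∀ (K : Type*) [Field K] (R : ℕ → ℤ → K),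
        QSystem.IsSolution r R → QSystem.Nonvanishing r R →
        R 1 ((n : ℤ) + m 1) = R 1 (m 1) * QSystem.pathZ r m R n ∧
        R 1 ((n : ℤ) + m 1) = P.eval (QSystem.seed r m R) := by
  refine ⟨QSystem.exists_unique_solution hm, QSystem.finite_rootPaths,
    fun e he => QSystem.isSeedMonomial_weight hm.motzkin he, fun n => ?_⟩
  -- The index where the minimum is attained supplies `1 ≤ r`.
  obtain ⟨α, h1, h2, _⟩ := hm.attained
  obtain ⟨P, hP⟩ := QSystem.isSeedPolynomial_pathZ (r := r) hm.motzkin n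
  refine ⟨P, fun K _ R hR hn => ?_⟩
  have h := hR.path_formula hn (h1.trans h2) hm.motzkin n
  exact ⟨h, h.trans (hP K R hR hn)⟩
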